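/- Let $I=[0,\pi]$, let $L^2(I,\mathbb C^2)$ carry the scalar product $\langle f,g\rangle=\frac1\pi\int_0^\pi (f_1\overline{g_1}+f_2\overline{g_2})\,dx$, and let $v=\begin{pmatrix}0&P\\Q&0\end{pmatrix}$ with $P,Q\in L^2(I)$. A boundary condition $bc$ is given by a matrix $\begin{pmatrix}a_1&b_1&a_2&b_2\\c_1&d_1&c_2&d_2\end{pmatrix}\in\mathbb C^{2\times4}$ through $a_1y_1(0)+b_1y_1(\pi)+a_2y_2(0)+b_2y_2(\pi)=0$, $c_1y_1(0)+d_1y_1(\pi)+c_2y_2(0)+d_2y_2(\pi)=0$. Let $A_{ij}$ be the submatrix of its $i$-th and $j$-th columns. The $bc$ is regular if $|A_{14}|\ne0$ and $|A_{23}|\neq0$ (determinants), and strictly regular if moreover $(|A_{13}|+|A_{24}|)^2\neq4|A_{14}||A_{23}|$. The Dirac operator is $$L_{bc}(v)y=i\begin{pmatrix}1&0\\0&-1\end{pmatrix}y'+vy,\qquad \mathrm{dom}\,L_{bc}(v)=\{y\in H^1(I,\mathbb C^2): y \text{ satisfies } bc\}.$$ Let $bc$ be regular but not strictly regular, and write $\begin{pmatrix}b&a\\d&c\end{pmatrix}=A_{14}^{-1}A_{23}$.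 Let $\tau_*\in\mathbb{C}$ satisfy $e^{i\pi\tau_*}=-(b+c)/2$ and $|\mathrm{Re}\,\tau_*|\le1$. If $b=c$, $a=d=0$ (periodic type), let $\kappa=0$ and let $\alpha,\beta\in\mathbb C^2$ be any two linearly independent vectors. Otherwise let $\kappa=1$, and take $\alpha=(0,d)$, $\beta=(\pi b,0)$ if $a=0$, and $\alpha=(a,(c-b)/2)$, $\beta=(0,\pi b)$ if $a\ne0$. Let $A$ be the isomorphism of $L^2(I,\mathbb C^2)$ $$A\begin{pmatrix}f\\g\end{pmatrix}(x)=\begin{pmatrix}\alpha_1e^{i\tau_*(\pi-x)}f(\pi-x)+(\beta_1-\kappa\alpha_1x)e^{i\tau_*(\pi-x)}g(\pi-x)\\ \alpha_2e^{i\tau_*x}f(x)+(\beta_2+\kappa\alpha_2x)e^{i\tau_*x}g(x)\end{pmatrix}.$$ For even integers $k$ put $e^1_k=(e^{ikx},0)$, $e^2_k=(0,e^{ikx})$, $\varphi_k^\nu=Ae_k^\nu$, $\tilde\varphi^\mu_k=(A^{-1})^*e^\mu_k$. The numbers $\langle v\varphi^\nu_k,\tilde\varphi^\mu_j\rangle$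 depend only on $j+k$ and are denoted $w^{\mu\nu}(j+k)$. Put $r(m)=\max_{\mu,\nu}|w^{\mu\nu}(m)|$, $\|r\|^2=\sum_{m\in2\mathbb Z}r(m)^2$, and $$T=\max\Big(1,\;2|\mathrm{Im}\,\tau_*|,\;192\,\|A\|\,\|A^{-1}\|\,\|r\|^2\Big).$$ For $N\in 2\mathbb N$ let $R_{NT}=\{x+it:\ |x-\mathrm{Re}\,\tau_*|<N+1,\ |t|<T\}$, and for $m\in2\mathbb Z$ let $D_m=\{z:\ |z-\tau_*-m|<1/4\}$. Theorem. For every regular but not strictly regular $bc$ and all $P,Q\in L^2(I)$ there is a positive even integer $N=N(v,bc)$ (independent of the choice of $\tau_*,\alpha,\beta$ above) such that for every $\zeta\in\mathbb C$ with $|\zeta|\le1$ $$\mathrm{Sp}\,L_{bc}(\zeta v)\ \subset\ R_{NT}\ \cup\bigcup_{m\in2\mathbb Z,\ |m|>N}D_m .$$ -/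

import Mathlib

open MeasureTheory Set
open scoped ENNReal

noncomputable section

namespace Dirac

/-! ### The Hilbert space `L²([0, π], ℂ²)` -/

/-- Normalized Lebesgue measure `dx / π` on the interval `[0, π]`. -/
def muI : Measure ℝ := ENNReal.ofReal (Real.pi⁻¹) • volume.restrict (Icc 0 Real.pi)

/-- The scalar space `L²([0, π])` (with the normalized measure). -/
abbrev L2 : Type := Lp ℂ 2 muI

/-- The Hilbert space `L²([0, π], ℂ²)` of pairs `y = (y₁, y₂)`, with
`⟨f, g⟩ = (1/π) ∫₀^π (f₁ conj g₁ + f₂ conj g₂) dx`. -/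
abbrev H : Type := WithLp 2 (L2 × L2)

/-! ### Boundary conditions -/

/-- The determinant of the `2 × 2` matrix formed by the columns `i` and `j` (numbered from `0`). -/
def colMinor (M : Matrix (Fin 2) (Fin 4) ℂ) (i j : Fin 4) : ℂ :=
  (M.submatrix id ![i, j]).det

/-- The pair of boundary conditions
`a₁ y₁(0) + b₁ y₁(π) + a₂ y₂(0) + b₂ y₂(π) = 0`,
`c₁ y₁(0) + d₁ y₁(π) + c₂ y₂(0) + d₂ y₂(π) = 0`
given by the matrix `M` with rows `(a₁, b₁, a₂, b₂)` and `(c₁, d₁, c₂, d₂)`. -/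
def SatisfiesBC (M : Matrix (Fin 2) (Fin 4) ℂ) (u₁ u₂ : ℝ → ℂ) : Prop :=
  M.mulVec ![u₁ 0, u₁ Real.pi, u₂ 0, u₂ Real.pi] = 0

/-- Regular boundary conditions. -/
def IsRegular (M : Matrix (Fin 2) (Fin 4) ℂ) : Prop :=
  colMinor M 0 3 ≠ 0 ∧ colMinor M 1 2 ≠ 0

/-- Strictly regular boundary conditions. -/
def IsStrictlyRegular (M : Matrix (Fin 2) (Fin 4) ℂ) : Prop :=
  IsRegular M ∧
    (colMinor M 0 2 + colMinor M 1 3) ^ 2 ≠ 4 * colMinor M 0 3 * colMinor M 1 2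

/-- The matrix `[[b, a], [d, c]] = A₁₄⁻¹ A₂₃`. For regular conditions, multiplication by `A₁₄⁻¹`
from the left brings them to the equivalent form
`y₁(0) + b y₁(π) + a y₂(0) = 0`, `d y₁(π) + c y₂(0) + y₂(π) = 0`. -/
def bcMatrix (M : Matrix (Fin 2) (Fin 4) ℂ) : Matrix (Fin 2) (Fin 2) ℂ :=
  (M.submatrix id ![0, 3])⁻¹ * M.submatrix id ![1, 2]

/-- The entry `b` of the normalized boundary conditions. -/
def bcb (M : Matrix (Fin 2) (Fin 4) ℂ) : ℂ := bcMatrix M 0 0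
/-- The entry `a` of the normalized boundary conditions. -/
def bca (M : Matrix (Fin 2) (Fin 4) ℂ) : ℂ := bcMatrix M 0 1
/-- The entry `d` of the normalized boundary conditions. -/
def bcd (M : Matrix (Fin 2) (Fin 4) ℂ) : ℂ := bcMatrix M 1 0
/-- The entry `c` of the normalized boundary conditions. -/
def bcc (M : Matrix (Fin 2) (Fin 4) ℂ) : ℂ := bcMatrix M 1 1

/-- Periodic type: `b = c`, `a = d = 0`. -/
def IsPeriodicType (M : Matrix (Fin 2) (Fin 4) ℂ) : Prop :=
  bcb M = bcc M ∧ bca M = 0 ∧ bcd M = 0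

/-- `τ` is an admissible exponent `τ_*`: `-(b + c)/2 = exp (i π τ)` and `|Re τ| ≤ 1`. -/
def IsExponent (M : Matrix (Fin 2) (Fin 4) ℂ) (τ : ℂ) : Prop :=
  -(bcb M + bcc M) / 2 = Complex.exp (Complex.I * Real.pi * τ) ∧ |τ.re| ≤ 1

/-- The vectors `α, β` from which the root functions of the free operator are built.
Periodic type: any two linearly independent vectors (all nonzero vectors are eigenvectors of
`[[b, a], [d, c]]`). Otherwise an explicit eigenvector `α` and an associated vector `β`. -/
def IsRootPair (M : Matrix (Fin 2) (Fin 4) ℂ) (α β : Fin 2 → ℂ) : Prop :=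
  (IsPeriodicType M → LinearIndependent ℂ ![α, β]) ∧
  (¬ IsPeriodicType M → bca M = 0 → α = ![0, bcd M] ∧ β = ![Real.pi * bcb M, 0]) ∧
  (¬ IsPeriodicType M → bca M ≠ 0 →
    α = ![bca M, (bcc M - bcb M) / 2] ∧ β = ![0, Real.pi * bcb M])

/-! ### The Dirac operator as an unbounded operator -/

/-- `f ∈ L²` belongs to the Sobolev space `H¹([0, π])`, with derivative `f' ∈ L²` and continuous
representative `u`. -/
def IsH1 (u : ℝ → ℂ) (f f' : L2) : Prop :=
  f =ᵐ[muI] u ∧ ∀ x ∈ Icc 0 Real.pi, u x = u 0 + ∫ t in (0 : ℝ)..x, f' t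

lemma ae_muI {p : ℝ → Prop} :
    (∀ᵐ x ∂muI, p x) ↔ ∀ᵐ x ∂(volume.restrict (Icc 0 Real.pi)), p x := by
  have h : ENNReal.ofReal (Real.pi⁻¹) ≠ 0 := by
    simp [Real.pi_pos]
  unfold muI
  rw [Measure.ae_ennreal_smul_measure_eq h]

instance : IsFiniteMeasure muI := by
  exact Measure.smul_finite _ ENNReal.ofReal_ne_top

lemma intervalIntegrable_L2 (f : L2) {a b : ℝ} (ha : a ∈ Icc 0 Real.pi) (hb : b ∈ Icc 0 Real.pi) :
    IntervalIntegrable f volume a b := by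
  have h1 : Integrable f muI := (Lp.memLp f).integrable (by norm_num)
  unfold muI at h1
  rw [integrable_smul_measure (by simp [Real.pi_pos]) (by simp)] at h1
  have h2 : IntegrableOn f (Icc 0 Real.pi) volume := h1
  exact (h2.mono_set (Set.uIcc_subset_Icc ha hb)).intervalIntegrable

lemma IsH1.add {u w : ℝ → ℂ} {f f' g g' : L2} (hu : IsH1 u f f') (hw : IsH1 w g g') :
    IsH1 (u + w) (f + g) (f' + g') := by
  refine ⟨?_, fun x hx => ?_⟩
  · filter_upwards [Lp.coeFn_add f g, hu.1, hw.1] with x h1 h2 h3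
    rw [h1, Pi.add_apply, Pi.add_apply, h2, h3]
  · have h0 : (0 : ℝ) ∈ Icc 0 Real.pi := ⟨le_rfl, Real.pi_pos.le⟩
    have h1 : ∫ t in (0 : ℝ)..x, (f' + g' : L2) t = ∫ t in (0 : ℝ)..x, (f' t + g' t) := by
      rw [intervalIntegral.integral_of_le hx.1, intervalIntegral.integral_of_le hx.1]
      apply integral_congr_ae
      have := ae_muI.1 (Lp.coeFn_add f' g')
      exact ae_mono (Measure.restrict_mono
        (fun t ht => ⟨ht.1.le, ht.2.trans hx.2⟩ : Ioc 0 x ⊆ Icc 0 Real.pi) le_rfl) this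
    rw [h1, intervalIntegral.integral_add (intervalIntegrable_L2 f' h0 hx)
      (intervalIntegrable_L2 g' h0 hx)]
    simp only [Pi.add_apply]
    rw [hu.2 x hx, hw.2 x hx]
    ring

lemma IsH1.smul {u : ℝ → ℂ} {f f' : L2} (c : ℂ) (hu : IsH1 u f f') :
    IsH1 (c • u) (c • f) (c • f') := by
  refine ⟨?_, fun x hx => ?_⟩
  · filter_upwards [Lp.coeFn_smul c f, hu.1] with x h1 h2
    simp [h1, h2]
  · have h1 : ∫ t in (0 : ℝ)..x, (c • f' : L2) t = ∫ t in (0 : ℝ)..x, c * f' t := by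
      rw [intervalIntegral.integral_of_le hx.1, intervalIntegral.integral_of_le hx.1]
      apply integral_congr_ae
      have := ae_muI.1 (Lp.coeFn_smul c f')
      exact ae_mono (Measure.restrict_mono
        (fun t ht => ⟨ht.1.le, ht.2.trans hx.2⟩ : Ioc 0 x ⊆ Icc 0 Real.pi) le_rfl) this
    rw [h1, intervalIntegral.integral_const_mul]
    simp only [Pi.smul_apply, smul_eq_mul]
    rw [hu.2 x hx]
    ring

/-- The graph of the Dirac operator `L_bc(v)`, `v = [[0, P], [Q, 0]]`: the pairs `(y, g)` with
`y ∈ H¹([0, π], ℂ²)` subject to the boundary conditions and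
`g = (i y₁' + P y₂, -i y₂' + Q y₁) ∈ L²`. -/
def graph (M : Matrix (Fin 2) (Fin 4) ℂ) (P Q : ℝ → ℂ) : Submodule ℂ (H × H) where
  carrier := {p | ∃ (u₁ u₂ : ℝ → ℂ) (y₁' y₂' : L2),
    IsH1 u₁ p.1.fst y₁' ∧ IsH1 u₂ p.1.snd y₂' ∧ SatisfiesBC M u₁ u₂ ∧
    (∀ᵐ x ∂muI, p.2.fst x = Complex.I * y₁' x + P x * u₂ x) ∧
    (∀ᵐ x ∂muI, p.2.snd x = -Complex.I * y₂' x + Q x * u₁ x)}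
  add_mem' := by
    rintro p q ⟨u₁, u₂, f₁, f₂, h1, h2, h3, h4, h5⟩ ⟨w₁, w₂, g₁, g₂, k1, k2, k3, k4, k5⟩
    refine ⟨u₁ + w₁, u₂ + w₂, f₁ + g₁, f₂ + g₂, h1.add k1, h2.add k2, ?_, ?_, ?_⟩
    · unfold SatisfiesBC at *
      have : ![(u₁ + w₁) 0, (u₁ + w₁) Real.pi, (u₂ + w₂) 0, (u₂ + w₂) Real.pi] =
          ![u₁ 0, u₁ Real.pi, u₂ 0, u₂ Real.pi] + ![w₁ 0, w₁ Real.pi, w₂ 0, w₂ Real.pi] := by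
        simp
      rw [this, Matrix.mulVec_add, h3, k3, add_zero]
    · filter_upwards [h4, k4, Lp.coeFn_add f₁ g₁, Lp.coeFn_add p.2.fst q.2.fst] with x a b c d
      simp only [Prod.snd_add, WithLp.add_fst, d, c, Pi.add_apply, a, b]
      ring
    · filter_upwards [h5, k5, Lp.coeFn_add f₂ g₂, Lp.coeFn_add p.2.snd q.2.snd] with x a b c d
      simp only [Prod.snd_add, WithLp.add_snd, d, c, Pi.add_apply, a, b]
      ring
  zero_mem' := by
    have h0 : IsH1 0 (0 : L2) 0 := by
      refine ⟨Lp.coeFn_zero _ _ _, fun x hx => ?_⟩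
      have h1 : ∫ t in (0 : ℝ)..x, (0 : L2) t = ∫ t in (0 : ℝ)..x, (0 : ℂ) := by
        rw [intervalIntegral.integral_of_le hx.1, intervalIntegral.integral_of_le hx.1]
        apply integral_congr_ae
        have := ae_muI.1 (Lp.coeFn_zero ℂ 2 muI)
        exact ae_mono (Measure.restrict_mono
          (fun t ht => ⟨ht.1.le, ht.2.trans hx.2⟩ : Ioc 0 x ⊆ Icc 0 Real.pi) le_rfl) this
      rw [h1]
      simp
    refine ⟨0, 0, 0, 0, h0, h0, ?_, ?_, ?_⟩
    · unfold SatisfiesBC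
      have : ![(0 : ℝ → ℂ) 0, (0 : ℝ → ℂ) Real.pi, (0 : ℝ → ℂ) 0, (0 : ℝ → ℂ) Real.pi] = 0 := by
        ext i
        fin_cases i <;> rfl
      rw [this, Matrix.mulVec_zero]
    · filter_upwards [Lp.coeFn_zero ℂ 2 muI] with x a
      change (0 : L2) x = Complex.I * (0 : L2) x + P x * 0
      rw [a]
      simp
    · filter_upwards [Lp.coeFn_zero ℂ 2 muI] with x a
      change (0 : L2) x = -Complex.I * (0 : L2) x + Q x * 0
      rw [a]
      simp
  smul_mem' := by
    rintro c p ⟨u₁, u₂, f₁, f₂, h1, h2, h3, h4, h5⟩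
    refine ⟨c • u₁, c • u₂, c • f₁, c • f₂, h1.smul c, h2.smul c, ?_, ?_, ?_⟩
    · unfold SatisfiesBC at *
      have : ![(c • u₁) 0, (c • u₁) Real.pi, (c • u₂) 0, (c • u₂) Real.pi] =
          c • ![u₁ 0, u₁ Real.pi, u₂ 0, u₂ Real.pi] := by
        simp
      rw [this, Matrix.mulVec_smul, h3, smul_zero]
    · filter_upwards [h4, Lp.coeFn_smul c f₁, Lp.coeFn_smul c p.2.fst] with x a b d
      simp only [Prod.smul_snd, WithLp.smul_fst, d, b, Pi.smul_apply, a, smul_eq_mul]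
      ring
    · filter_upwards [h5, Lp.coeFn_smul c f₂, Lp.coeFn_smul c p.2.snd] with x a b d
      simp only [Prod.smul_snd, WithLp.smul_snd, d, b, Pi.smul_apply, a, smul_eq_mul]
      ring

/-- The Dirac operator `L_bc(v)` as an unbounded operator in `L²([0, π], ℂ²)`. -/
def op (M : Matrix (Fin 2) (Fin 4) ℂ) (P Q : ℝ → ℂ) : H →ₗ.[ℂ] H :=
  (graph M P Q).toLinearPMap

lemma IsH1.eq_zero {u : ℝ → ℂ} {f' : L2} (h : IsH1 u 0 f') :
    (∀ x ∈ Icc 0 Real.pi, u x = 0) ∧ f' = 0 := by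
  have h0 : (0 : ℝ) ∈ Icc 0 Real.pi := ⟨le_rfl, Real.pi_pos.le⟩
  have hpi : Real.pi ∈ Icc 0 Real.pi := ⟨Real.pi_pos.le, le_rfl⟩
  have hint := intervalIntegrable_L2 f' h0 hpi
  have hc : ContinuousOn u (Icc 0 Real.pi) := by
    have h1 : ContinuousOn (fun x => u 0 + ∫ t in (0 : ℝ)..x, f' t) (Icc 0 Real.pi) := by
      have := intervalIntegral.continuousOn_primitive_interval' hint Set.left_mem_uIcc
      rw [Set.uIcc_of_le Real.pi_pos.le] at this
      exact continuousOn_const.add this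
    exact h1.congr h.2
  have hz : ∀ x ∈ Icc 0 Real.pi, u x = 0 := by
    have hae : u =ᵐ[volume.restrict (Icc 0 Real.pi)] fun _ => 0 := by
      apply ae_muI.1
      filter_upwards [h.1, Lp.coeFn_zero ℂ 2 muI] with x a b
      rw [← a, b]
      rfl
    exact Measure.eqOn_Icc_of_ae_eq volume Real.pi_pos.ne hae hc continuousOn_const
  refine ⟨hz, ?_⟩
  apply Lp.ext
  have hd := hint.ae_hasDerivAt_integral
  rw [Set.uIcc_of_le Real.pi_pos.le] at hd
  have hne : ∀ a : ℝ, ∀ᵐ x : ℝ, x ≠ a := fun a => by simp [ae_iff, measure_singleton]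
  have key : ∀ᵐ x ∂(volume.restrict (Icc 0 Real.pi)), f' x = 0 := by
    rw [ae_restrict_iff' measurableSet_Icc]
    filter_upwards [hd, hne 0, hne Real.pi] with x hx hx0 hx1 hmem
    have hlt : x ∈ Ioo 0 Real.pi :=
      ⟨lt_of_le_of_ne hmem.1 (Ne.symm hx0), lt_of_le_of_ne hmem.2 hx1⟩
    have e : (fun y => ∫ t in (0 : ℝ)..y, f' t) =ᶠ[nhds x] fun _ => (0 : ℂ) := by
      filter_upwards [isOpen_Ioo.mem_nhds hlt] with y hy
      have hy' : y ∈ Icc 0 Real.pi := Ioo_subset_Icc_self hy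
      have := h.2 y hy'
      rw [hz y hy', hz 0 h0, zero_add] at this
      exact this.symm
    exact ((hx hmem 0 h0).congr_of_eventuallyEq e.symm).unique (hasDerivAt_const x (0 : ℂ))
  filter_upwards [ae_muI.2 key, Lp.coeFn_zero ℂ 2 muI] with x a b
  rw [a, b]
  rfl

/-- The relation `graph` is single valued, so it is the graph of `op`. -/
lemma op_graph (M : Matrix (Fin 2) (Fin 4) ℂ) (P Q : ℝ → ℂ) :
    (op M P Q).graph = graph M P Q := by
  apply Submodule.toLinearPMap_graph_eq
  rintro ⟨y, g⟩ ⟨u₁, u₂, f₁, f₂, h1, h2, -, h4, h5⟩ hy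
  simp only at hy h1 h2 h4 h5
  subst hy
  obtain ⟨z1, rfl⟩ := IsH1.eq_zero h1
  obtain ⟨z2, rfl⟩ := IsH1.eq_zero h2
  have hmem : ∀ᵐ x ∂muI, x ∈ Icc 0 Real.pi :=
    ae_muI.2 (ae_restrict_mem measurableSet_Icc)
  have e1 : g.fst = 0 := by
    apply Lp.ext
    filter_upwards [h4, Lp.coeFn_zero ℂ 2 muI, hmem] with x a b c
    rw [a, b, z2 x c]
    simp
  have e2 : g.snd = 0 := by
    apply Lp.ext
    filter_upwards [h5, Lp.coeFn_zero ℂ 2 muI, hmem] with x a b c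
    rw [a, b, z1 x c]
    simp
  apply (WithLp.equiv 2 _).injective
  exact Prod.ext e1 e2

/-- The resolvent set of an unbounded operator `T`: those `z` for which `z - T`, defined on the
domain of `T`, has a bounded everywhere defined two-sided inverse. -/
def resolventSet (T : H →ₗ.[ℂ] H) : Set ℂ :=
  {z | ∃ R : H →L[ℂ] H,
    (∀ f : H, ∃ h : R f ∈ T.domain, z • R f - T ⟨R f, h⟩ = f) ∧
    (∀ y : T.domain, R (z • (y : H) - T y) = y)}

/-- The spectrum of an unbounded operator. -/
def Sp (T : H →ₗ.[ℂ] H) : Set ℂ := (resolventSet T)ᶜ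

/-! ### The isomorphism `A`, the Riesz basis of root functions and the sequence `r` -/

lemma memLp_of_continuous {h : ℝ → ℂ} (hh : Continuous h) (p : ℝ≥0∞) : MemLp h p muI := by
  obtain ⟨C, hC⟩ := isCompact_Icc.exists_bound_of_continuousOn (s := Icc 0 Real.pi)
    hh.continuousOn
  refine MemLp.of_bound hh.aestronglyMeasurable C ?_
  exact ae_muI.2 ((ae_restrict_mem measurableSet_Icc).mono fun x hx => hC x hx)

/-- Multiplication by a continuous function, as a bounded operator in `L²([0, π])`. -/
def mulOp (h : ℝ → ℂ) (hh : Continuous h) : L2 →L[ℂ] L2 :=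
  (ContinuousLinearMap.mul ℂ ℂ).holderL muI ∞ 2 2 ((memLp_of_continuous hh ∞).toLp h)

lemma measurePreserving_reflect : MeasurePreserving (fun x : ℝ => Real.pi - x) muI muI := by
  unfold muI
  apply MeasurePreserving.smul_measure
  have h : MeasurePreserving (fun x : ℝ => Real.pi - x) volume volume :=
    volume.measurePreserving_sub_left Real.pi
  have := h.restrict_preimage (s := Icc 0 Real.pi) measurableSet_Icc
  simpa using this

/-- The reflection `f(x) ↦ f(π - x)` in `L²([0, π])`. -/
def reflect : L2 →L[ℂ] L2 :=
  (Lp.compMeasurePreservingₗᵢ ℂ (fun x : ℝ => Real.pi - x)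
    measurePreserving_reflect).toContinuousLinearMap

/-- The operator
`(f, g) ↦ (α₁ e^{iτ(π-x)} f(π-x) + (β₁ - κ α₁ x) e^{iτ(π-x)} g(π-x),`
`α₂ e^{iτx} f(x) + (β₂ + κ α₂ x) e^{iτx} g(x))`. -/
def basisOpAux (κ τ : ℂ) (α β : Fin 2 → ℂ) : H →L[ℂ] H :=
  ((WithLp.prodContinuousLinearEquiv 2 ℂ L2 L2).symm : L2 × L2 →L[ℂ] H) ∘L
    (ContinuousLinearMap.prod
      ((mulOp (fun x => α 0 * Complex.exp (Complex.I * τ * (Real.pi - x))) (by fun_prop)) ∘L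
          reflect ∘L ContinuousLinearMap.fst ℂ L2 L2 +
        (mulOp (fun x => (β 0 - κ * α 0 * x) * Complex.exp (Complex.I * τ * (Real.pi - x)))
            (by fun_prop)) ∘L
          reflect ∘L ContinuousLinearMap.snd ℂ L2 L2)
      ((mulOp (fun x => α 1 * Complex.exp (Complex.I * τ * x)) (by fun_prop)) ∘L
          ContinuousLinearMap.fst ℂ L2 L2 +
        (mulOp (fun x => (β 1 + κ * α 1 * x) * Complex.exp (Complex.I * τ * x))
            (by fun_prop)) ∘L
          ContinuousLinearMap.snd ℂ L2 L2)) ∘L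
    ((WithLp.prodContinuousLinearEquiv 2 ℂ L2 L2) : H →L[ℂ] L2 × L2)

open Classical in
/-- The isomorphism `A` of `L²([0, π], ℂ²)` that maps the standard orthonormal basis to the basis
of root functions of the free operator (no associated functions for periodic type). -/
def basisOp (M : Matrix (Fin 2) (Fin 4) ℂ) (τ : ℂ) (α β : Fin 2 → ℂ) : H →L[ℂ] H :=
  basisOpAux (if IsPeriodicType M then 0 else 1) τ α β

/-- The function `e^{ikx}` in `L²([0, π])`. -/
def expFun (k : ℤ) : L2 :=
  (memLp_of_continuous (h := fun x : ℝ => Complex.exp (Complex.I * k * x)) (by fun_prop) 2).toLp _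

/-- The orthonormal basis `e_k^1 = (e^{ikx}, 0)`, `e_k^2 = (0, e^{ikx})`, `k` even
(the upper index `1, 2` is `0, 1` here). -/
def stdBasis (ν : Fin 2) (k : ℤ) : H :=
  if ν = 0 then WithLp.toLp 2 (expFun k, 0) else WithLp.toLp 2 (0, expFun k)

/-- The root functions `φ_k^ν = A e_k^ν` of the free operator. -/
def rootFun (A : H →L[ℂ] H) (ν : Fin 2) (k : ℤ) : H := A (stdBasis ν k)

/-- The biorthogonal system `(A⁻¹)^* e_k^ν`. -/
def biorthFun (A : H →L[ℂ] H) (ν : Fin 2) (k : ℤ) : H :=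
  ContinuousLinearMap.adjoint A.inverse (stdBasis ν k)

/-- The matrix element `⟨V φ_k^ν, biorthFun_j^μ⟩` of multiplication by `v = [[0, P], [Q, 0]]`. -/
def matElem (A : H →L[ℂ] H) (P Q : ℝ → ℂ) (μ ν : Fin 2) (j k : ℤ) : ℂ :=
  ∫ x, (P x * (rootFun A ν k).snd x * starRingEnd ℂ ((biorthFun A μ j).fst x) +
    Q x * (rootFun A ν k).fst x * starRingEnd ℂ ((biorthFun A μ j).snd x)) ∂muI

/-- `r(m) = max_{μ,ν} |w^{μν}(m)|`, `m` even, where `w^{μν}(j + k) = matElem μ ν j k`. -/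
def rSeq (A : H →L[ℂ] H) (P Q : ℝ → ℂ) (m : ℤ) : ℝ :=
  ⨆ p : Fin 2 × Fin 2, ‖matElem A P Q p.1 p.2 m 0‖

/-- `‖r‖²`, the square of the norm of `r` in `ℓ²(2ℤ)`. -/
def rNormSq (A : H →L[ℂ] H) (P Q : ℝ → ℂ) : ℝ := ∑' n : ℤ, rSeq A P Q (2 * n) ^ 2

/-! ### The localization sets -/

/-- `T = max (1, 2 |Im τ|, 2 · 96 ‖A‖ ‖A⁻¹‖ ‖r‖²)`. -/
def height (M : Matrix (Fin 2) (Fin 4) ℂ) (P Q : ℝ → ℂ) (τ : ℂ) (α β : Fin 2 → ℂ) : ℝ :=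
  max 1 (2 * max |τ.im|
    (96 * ‖basisOp M τ α β‖ * ‖(basisOp M τ α β).inverse‖ * rNormSq (basisOp M τ α β) P Q))

/-- The rectangle `R_{NT} = {x + it : |x - Re τ| < N + 1, |t| < T}`. -/
def rect (τ : ℂ) (N : ℕ) (T : ℝ) : Set ℂ :=
  {z | |z.re - τ.re| < N + 1 ∧ |z.im| < T}

/-- The disc `D_m` of radius `1/4` about `τ + m`. -/
def disc (τ : ℂ) (m : ℤ) : Set ℂ := {z | ‖z - τ - m‖ < 1 / 4}

end Dirac

end

/-!
The proof rests on an explicit formula for the resolvent. Write `L⁰` for the free operator and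
`z = λ - τ`.

*The free operator.* For a regular, not strictly regular boundary condition the matrix
`[[b, a], [d, c]]` has the double eigenvalue `-exp (iπτ)`, with `α` in the kernel of
`[[b, a], [d, c]] + exp (iπτ)` and `β` an associated vector (`RootData`). Consequently `A` is
invertible, and `A⁻¹ L⁰ A` is `-i d/dx + τ` with periodic boundary conditions, plus a nilpotent
matrix with the entry `-iκ`. Its resolvent `D` is built from the Fourier multiplier `1 / (z - 2n)`
(`multB`, `freeSol`, `exists_isH1_free`). This multiplier maps `L²` to bounded continuous functions
with norm at most `σ(z) = (∑ |z - 2n|⁻²)^{1/2}` (`sig`).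

*The perturbation.* `A` carries multiplication by a scalar function `h` to multiplication by
`(h(π - x), h(x))`, and `v` exchanges the two components. Therefore `G = A⁻¹ v A D`
(`perturbOp`) is `D` followed by the reflection `x ↦ π - x` and by multiplication by a fixed
`2 × 2` matrix of `L²` functions, which is legitimate because `D` takes values in bounded functions.
The numbers `w^{μν}(m)` are the Fourier coefficients of this matrix (`matElem_eq`), so by Parseval's
identity `‖r‖` bounds the norms of its entries. If `1 - ζ G` is invertible, then `λ` lies in the
resolvent set and `(λ - L⁰ - ζ v)⁻¹ = A D (1 - ζ G)⁻¹ A⁻¹` (`mem_resolventSet_of_isUnit`). No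
compactness is needed, since injectivity is checked directly.

*Large imaginary part.* If `|Im λ| ≥ T`, then `|Im z| ≥ T / 2`, hence `σ(z)² ≤ 8 / T` and
`‖G‖² ≤ 20 ‖r‖² σ(z)² ≤ 160 ‖r‖² / T ≤ 160 / 192 < 1`, where `‖A‖ ‖A⁻¹‖ ≥ 1` was used
(`isUnit_of_im`).

*Large real part.* If `|z - 2n| ≥ 1/4` for all `n`, then `‖G‖` is only bounded, but `‖G²‖ → 0` as
`|z| → ∞` (`norm_perturbOp_perturbOp_le`), and `1 - ζ² G²` is a multiple of `1 - ζ G`. Every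
term of `G²` contains an operator `S f R S` (`sandwich`), where `S` is the multiplier, `R` the reflection and
`f ∈ L²`. For `f = e^{2imx}` the partial fraction identity
`1 / ((z - 2k) (z - 2(m - k))) = (1 / (z - 2k) + 1 / (z - 2(m - k))) / (2z - 2m)` gives a factor
`1 / |2z - 2m|`, and density of the trigonometric polynomials gives the decay for all `f`
(`decays`).

*Uniformity of `N`.* The condition on large real parts concerns only the operator and the set
`τ + 2ℤ`, which is the same for all admissible `τ`. So `N` may be computed from one choice of
`τ`, `α`, `β`, while the bound for large imaginary parts is used for the given one.
-/

noncomputable section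

namespace Dirac

/-! ### The orthonormal basis of exponentials with even exponents -/

instance : IsProbabilityMeasure muI := by
  constructor
  simp only [muI, Measure.smul_apply, Measure.restrict_apply_univ, Real.volume_Icc, sub_zero,
    smul_eq_mul]
  rw [← ENNReal.ofReal_mul (by positivity), inv_mul_cancel₀ Real.pi_ne_zero, ENNReal.ofReal_one]

lemma integral_muI (f : ℝ → ℂ) :
    ∫ x, f x ∂muI = (Real.pi : ℂ)⁻¹ * ∫ x in (0 : ℝ)..Real.pi, f x := by
  rw [muI, integral_smul_measure, ENNReal.toReal_ofReal (by positivity),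
    intervalIntegral.integral_of_le Real.pi_pos.le, integral_Icc_eq_integral_Ioc]
  simp

lemma coeFn_expFun (k : ℤ) : expFun k =ᵐ[muI] fun x : ℝ => Complex.exp (Complex.I * k * x) :=
  MemLp.coeFn_toLp _

lemma inner_expFun (k : ℤ) (f : L2) :
    inner ℂ (expFun k) f = ∫ x : ℝ, Complex.exp (-(Complex.I * k * x)) * f x ∂muI := by
  rw [L2.inner_def]
  apply integral_congr_ae
  filter_upwards [coeFn_expFun k] with x hx
  rw [hx, RCLike.inner_apply, ← Complex.exp_conj, mul_comm]
  simp

lemma integral_exp_even (n : ℤ) (hn : n ≠ 0) :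
    ∫ x : ℝ in (0 : ℝ)..Real.pi, Complex.exp (2 * Complex.I * n * x) = 0 := by
  have hc : (2 * Complex.I * n : ℂ) ≠ 0 := by simp [hn]
  rw [integral_exp_mul_complex hc]
  have : Complex.exp (2 * Complex.I * n * Real.pi) = 1 := by
    rw [Complex.exp_eq_one_iff]
    exact ⟨n, by ring⟩
  simp [this]

lemma orthonormal_expFun : Orthonormal ℂ (fun n : ℤ => expFun (2 * n)) := by
  rw [orthonormal_iff_ite]
  intro m n
  have h : inner ℂ (expFun (2 * m)) (expFun (2 * n)) =
      (Real.pi : ℂ)⁻¹ * ∫ x : ℝ in (0 : ℝ)..Real.pi,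
        Complex.exp (2 * Complex.I * ((n - m : ℤ) : ℂ) * x) := by
    rw [inner_expFun, ← integral_muI]
    apply integral_congr_ae
    filter_upwards [coeFn_expFun (2 * n)] with x hx
    rw [hx, ← Complex.exp_add]
    congr 1
    push_cast
    ring
  rw [h]
  split_ifs with hmn
  · subst hmn
    have := Complex.ofReal_ne_zero.2 Real.pi_ne_zero
    simp [this]
  · rw [integral_exp_even _ (sub_ne_zero.2 (Ne.symm hmn)), mul_zero]

lemma eq_zero_of_inner_expFun {f : L2} (hf : ∀ n : ℤ, inner ℂ (expFun (2 * n)) f = 0) :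
    f = 0 := by
  have hmem : MemLp f 2 (volume.restrict (Ioc 0 Real.pi)) := by
    refine MemLp.of_measure_le_smul (c := ENNReal.ofReal Real.pi) ENNReal.ofReal_ne_top ?_
      (Lp.memLp f)
    rw [muI, smul_smul, ← ENNReal.ofReal_mul Real.pi_pos.le, mul_inv_cancel₀ Real.pi_ne_zero,
      ENNReal.ofReal_one, one_smul]
    exact Measure.restrict_mono Ioc_subset_Icc_self le_rfl
  have hz : ∀ n : ℤ, fourierCoeffOn Real.pi_pos f n = 0 := by
    intro n
    rw [fourierCoeffOn_eq_integral, ← hf n, inner_expFun, integral_muI]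
    simp only [sub_zero, one_div, smul_eq_mul, fourier_coe_apply]
    rw [Complex.real_smul, Complex.ofReal_inv]
    congr 1
    apply intervalIntegral.integral_congr
    intro x _
    have := Complex.ofReal_ne_zero.2 Real.pi_ne_zero
    simp only
    congr 2
    push_cast
    field_simp
  have hs := hasSum_sq_fourierCoeffOn Real.pi_pos hmem
  simp only [hz, norm_zero, ne_eq, OfNat.ofNat_ne_zero, not_false_eq_true, zero_pow] at hs
  have h0 := hs.unique hasSum_zero
  have h1 : inner ℂ f f = 0 := by
    rw [L2.inner_def]
    have : ∀ x, inner ℂ (f x) (f x) = ((‖f x‖ ^ 2 : ℝ) : ℂ) := by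
      intro x
      rw [inner_self_eq_norm_sq_to_K]
      norm_cast
    simp only [this]
    rw [integral_muI, intervalIntegral.integral_ofReal, ← Complex.ofReal_inv, ← Complex.ofReal_mul]
    rw [sub_zero, smul_eq_mul] at h0
    rw [h0]
    simp
  exact inner_self_eq_zero.1 h1

/-- The exponentials `e^{2inx}` form a Hilbert basis of `L²([0, π])`. -/
def expBasis : HilbertBasis ℤ ℂ L2 :=
  HilbertBasis.mkOfOrthogonalEqBot orthonormal_expFun (by
    rw [Submodule.eq_bot_iff]
    intro f hf
    apply eq_zero_of_inner_expFun
    intro n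
    exact (Submodule.mem_orthogonal _ _).1 hf _ (Submodule.subset_span ⟨n, rfl⟩))

lemma coe_expBasis : ⇑expBasis = fun n : ℤ => expFun (2 * n) :=
  HilbertBasis.coe_mkOfOrthogonalEqBot _ _

lemma hasSum_norm_inner_sq (f : L2) :
    HasSum (fun n : ℤ => ‖(inner ℂ (expFun (2 * n)) f : ℂ)‖ ^ 2) (‖f‖ ^ 2) := by
  have h := expBasis.hasSum_inner_mul_inner f f
  rw [inner_self_eq_norm_sq_to_K] at h
  rw [coe_expBasis] at h
  have e : ∀ n : ℤ, inner ℂ f (expFun (2 * n)) * inner ℂ (expFun (2 * n)) f =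
      ((‖(inner ℂ (expFun (2 * n)) f : ℂ)‖ ^ 2 : ℝ) : ℂ) := by
    intro n
    rw [← inner_conj_symm, Complex.conj_mul']
    norm_cast
  simp only [e] at h
  have h2 := Complex.hasSum_re h
  simp only [Complex.ofReal_re] at h2
  convert h2 using 1
  norm_cast

/-- Two bounded operators on `L²` agree if they agree on all exponentials `e^{2inx}`. -/
lemma clm_ext_expFun {E : Type*} [NormedAddCommGroup E] [NormedSpace ℂ E] {S T : L2 →L[ℂ] E}
    (h : ∀ n : ℤ, S (expFun (2 * n)) = T (expFun (2 * n))) : S = T := by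
  apply ContinuousLinearMap.ext_on (s := range expBasis)
  · have := expBasis.dense_span
    exact (Submodule.dense_iff_topologicalClosure_eq_top).2 this
  · rintro _ ⟨n, rfl⟩
    rw [coe_expBasis]
    exact h n

/-! ### Bounded continuous functions and multiplication operators -/

/-- Bounded continuous functions on the real line, with the supremum norm. Continuous functions
on `[0, π]` enter as their restrictions. -/
abbrev Cb : Type := BoundedContinuousFunction ℝ ℂ

/-- The inclusion of bounded continuous functions in `L²([0, π])`. -/
def toL2 : Cb →L[ℂ] L2 := BoundedContinuousFunction.toLp 2 muI ℂ

lemma coeFn_toL2 (h : Cb) : toL2 h =ᵐ[muI] h := BoundedContinuousFunction.coeFn_toLp _ _ _ _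

lemma norm_toL2_le (h : Cb) : ‖toL2 h‖ ≤ ‖h‖ := by
  have h1 : ‖toL2‖ ≤ _ := BoundedContinuousFunction.toLp_norm_le (𝕜 := ℂ) muI
  have h2 := toL2.le_of_opNorm_le h1 h
  simpa [measureUnivNNReal] using h2

/-- The exponential `e^{2inx}` as a bounded continuous function. -/
def expB (n : ℤ) : Cb :=
  BoundedContinuousFunction.ofNormedAddCommGroup
    (fun x : ℝ => Complex.exp (Complex.I * ((2 * n : ℤ) : ℂ) * x)) (by fun_prop) 1 (by
      intro x
      rw [Complex.norm_exp]
      simp)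

lemma expB_apply (n : ℤ) (x : ℝ) :
    expB n x = Complex.exp (Complex.I * ((2 * n : ℤ) : ℂ) * x) := rfl

lemma norm_expB_le (n : ℤ) : ‖expB n‖ ≤ 1 :=
  BoundedContinuousFunction.norm_ofNormedAddCommGroup_le _ zero_le_one _

lemma toL2_expB (n : ℤ) : toL2 (expB n) = expFun (2 * n) := by
  apply Lp.ext
  filter_upwards [coeFn_toL2 (expB n), coeFn_expFun (2 * n)] with x h1 h2
  rw [h1, h2, expB_apply]

lemma expB_mul (m n : ℤ) (x : ℝ) : expB m x * expB n x = expB (m + n) x := by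
  simp only [expB_apply, ← Complex.exp_add]
  congr 1
  push_cast
  ring

/-- The reflection `h(x) ↦ h(π - x)` of bounded continuous functions. -/
def reflB : Cb →L[ℂ] Cb :=
  LinearMap.mkContinuous
    { toFun := fun h => h.compContinuous ⟨fun x : ℝ => Real.pi - x, by fun_prop⟩
      map_add' := fun _ _ => rfl
      map_smul' := fun _ _ => rfl } 1 (by
    intro h
    rw [one_mul]
    exact (BoundedContinuousFunction.norm_le (norm_nonneg _)).2 fun _ => h.norm_coe_le_norm _)

@[simp] lemma reflB_apply (h : Cb) (x : ℝ) : reflB h x = h (Real.pi - x) := rfl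

lemma norm_reflB_le (h : Cb) : ‖reflB h‖ ≤ ‖h‖ :=
  (BoundedContinuousFunction.norm_le (norm_nonneg _)).2 fun _ => h.norm_coe_le_norm _

lemma reflB_expB (n : ℤ) : reflB (expB n) = expB (-n) := by
  ext x
  rw [reflB_apply, expB_apply, expB_apply, Complex.exp_eq_exp_iff_exists_int]
  exact ⟨n, by push_cast; ring⟩

lemma reflB_reflB (h : Cb) : reflB (reflB h) = h := by
  ext x
  simp

/-- Multiplication of `L²` functions by bounded continuous functions. -/
def mulB : Cb →L[ℂ] L2 →L[ℂ] L2 :=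
  ((ContinuousLinearMap.mul ℂ ℂ).holderL muI ∞ 2 2) ∘L BoundedContinuousFunction.toLp ∞ muI ℂ

lemma coeFn_mulB (h : Cb) (f : L2) : mulB h f =ᵐ[muI] fun x => h x * f x := by
  have h1 := (ContinuousLinearMap.mul ℂ ℂ).coeFn_holder (r := 2)
    (BoundedContinuousFunction.toLp ∞ muI ℂ h) f
  filter_upwards [h1, BoundedContinuousFunction.coeFn_toLp ∞ muI ℂ h] with x h1 h2
  refine h1.trans ?_
  rw [h2]
  rfl

lemma mulB_apply (h : Cb) (f : L2) : mulB h f =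
    (ContinuousLinearMap.mul ℂ ℂ).holder 2 (BoundedContinuousFunction.toLp ∞ muI ℂ h) f := rfl

lemma norm_toLp_top_le (h : Cb) : ‖BoundedContinuousFunction.toLp ∞ muI ℂ h‖ ≤ ‖h‖ := by
  have h2 : ‖BoundedContinuousFunction.toLp ∞ muI ℂ h‖ ≤ _ :=
    BoundedContinuousFunction.Lp_norm_le h
  rw [ENNReal.toReal_top] at h2
  rw [inv_zero, Real.rpow_zero] at h2
  rwa [one_mul] at h2

lemma norm_mulB_le (h : Cb) (f : L2) : ‖mulB h f‖ ≤ ‖h‖ * ‖f‖ := by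
  have h1 := (ContinuousLinearMap.mul ℂ ℂ).norm_holder_apply_apply_le (r := 2)
    (BoundedContinuousFunction.toLp ∞ muI ℂ h) f
  have h3 : ‖ContinuousLinearMap.mul ℂ ℂ‖ ≤ 1 := ContinuousLinearMap.opNorm_mul_le ℂ ℂ
  have h2 := norm_toLp_top_le h
  rw [← mulB_apply] at h1
  have h4 : ‖ContinuousLinearMap.mul ℂ ℂ‖ * ‖BoundedContinuousFunction.toLp ∞ muI ℂ h‖ ≤ ‖h‖ := by
    nlinarith [norm_nonneg (BoundedContinuousFunction.toLp ∞ muI ℂ h)]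
  exact h1.trans (mul_le_mul_of_nonneg_right h4 (norm_nonneg f))

lemma mulB_toL2 (h k : Cb) : mulB h (toL2 k) = toL2 (h * k) := by
  apply Lp.ext
  filter_upwards [coeFn_mulB h (toL2 k), coeFn_toL2 k, coeFn_toL2 (h * k)] with x h1 h2 h3
  rw [h1, h2, h3]
  rfl

lemma coeFn_mulOp (h : ℝ → ℂ) (hh : Continuous h) (f : L2) :
    mulOp h hh f =ᵐ[muI] fun x => h x * f x := by
  have h1 := (ContinuousLinearMap.mul ℂ ℂ).coeFn_holder (r := 2)
    ((memLp_of_continuous hh ∞).toLp h) f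
  filter_upwards [h1, (memLp_of_continuous hh ∞).coeFn_toLp] with x h1 h2
  refine h1.trans ?_
  rw [h2]
  rfl

lemma coeFn_reflect (f : L2) : reflect f =ᵐ[muI] fun x => f (Real.pi - x) :=
  Lp.coeFn_compMeasurePreserving f measurePreserving_reflect

lemma ae_reflect {p : ℝ → Prop} (h : ∀ᵐ x ∂muI, p x) : ∀ᵐ x ∂muI, p (Real.pi - x) :=
  measurePreserving_reflect.quasiMeasurePreserving.ae h

lemma ae_mem_Icc : ∀ᵐ x ∂muI, x ∈ Icc 0 Real.pi :=
  ae_muI.2 (ae_restrict_mem measurableSet_Icc)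

/-! ### The sums `∑ |z - 2n|⁻²` -/

/-- The sums are indexed relative to the even integer nearest to `Re z`. -/
lemma abs_re_sub_ge (z : ℂ) (n : ℤ) :
    2 * |(n : ℝ)| - 1 ≤ |(z - 2 * ((n + round (z.re / 2) : ℤ) : ℂ)).re| := by
  have h := abs_sub_round (z.re / 2)
  have e : (z - 2 * ((n + round (z.re / 2) : ℤ) : ℂ)).re =
      2 * (z.re / 2 - round (z.re / 2)) - 2 * n := by
    simp
    ring
  rw [e]
  have h1 := abs_sub_abs_le_abs_sub (2 * (n : ℝ)) (2 * (z.re / 2 - round (z.re / 2)))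
  rw [abs_sub_comm, abs_mul, abs_mul, abs_two] at h1
  linarith

lemma norm_inv_sq_le (z : ℂ) (n : ℤ) :
    ‖(z - 2 * ((n + round (z.re / 2) : ℤ) : ℂ))⁻¹‖ ^ 2 ≤
      (if n = 0 then ‖(z - 2 * (round (z.re / 2) : ℂ))⁻¹‖ ^ 2 else 0) + 1 / (n : ℝ) ^ 2 := by
  split_ifs with hn
  · subst hn
    simp
  · have h1 := (abs_re_sub_ge z n).trans (Complex.abs_re_le_norm _)
    have h2 : (1 : ℝ) ≤ |(n : ℝ)| := by exact_mod_cast Int.one_le_abs hn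
    have h3 : |(n : ℝ)| ≤ ‖z - 2 * ((n + round (z.re / 2) : ℤ) : ℂ)‖ := by linarith
    rw [zero_add, norm_inv, inv_pow, ← one_div, ← sq_abs (n : ℝ)]
    gcongr

lemma summable_majorant (C : ℝ) :
    Summable fun n : ℤ => (if n = 0 then C else 0) + 1 / (n : ℝ) ^ 2 :=
  (hasSum_ite_eq 0 C).summable.add (Real.summable_one_div_int_pow.2 one_lt_two)

lemma summable_inv_sq (z : ℂ) : Summable fun n : ℤ => ‖(z - 2 * n)⁻¹‖ ^ 2 := by
  rw [← (Equiv.addRight (round (z.re / 2))).summable_iff]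
  exact (summable_majorant _).of_nonneg_of_le (fun _ => sq_nonneg _) (norm_inv_sq_le z)

lemma tsum_inv_sq_shift (z : ℂ) : ∑' n : ℤ, ‖(z - 2 * n)⁻¹‖ ^ 2 =
    ∑' n : ℤ, ‖(z - 2 * ((n + round (z.re / 2) : ℤ) : ℂ))⁻¹‖ ^ 2 :=
  ((Equiv.addRight (round (z.re / 2))).tsum_eq fun n : ℤ => ‖(z - 2 * n)⁻¹‖ ^ 2).symm

lemma tsum_inv_sq_le_of_dist {z : ℂ} (hz : ∀ n : ℤ, 1 / 4 ≤ ‖z - 2 * n‖) :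
    ∑' n : ℤ, ‖(z - 2 * n)⁻¹‖ ^ 2 ≤ 16 + ∑' n : ℤ, 1 / (n : ℝ) ^ 2 := by
  have hC : ‖(z - 2 * (round (z.re / 2) : ℂ))⁻¹‖ ^ 2 ≤ 16 := by
    have h := hz (round (z.re / 2))
    have h1 : ‖(z - 2 * (round (z.re / 2) : ℂ))⁻¹‖ ≤ 4 := by
      rw [norm_inv]
      exact inv_le_of_inv_le₀ (by norm_num) (by linarith)
    calc _ ≤ (4 : ℝ) ^ 2 := by gcongr
      _ = 16 := by norm_num
  have hs : Summable fun n : ℤ => 1 / (n : ℝ) ^ 2 := Real.summable_one_div_int_pow.2 one_lt_two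
  have hsum := (hasSum_ite_eq (0 : ℤ) (16 : ℝ)).add hs.hasSum
  rw [tsum_inv_sq_shift]
  have hs2 : Summable fun n : ℤ => ‖(z - 2 * ((n + round (z.re / 2) : ℤ) : ℂ))⁻¹‖ ^ 2 :=
    ((Equiv.addRight (round (z.re / 2))).summable_iff
      (f := fun n : ℤ => ‖(z - 2 * n)⁻¹‖ ^ 2)).2 (summable_inv_sq z)
  have hle : ∀ n : ℤ, ‖(z - 2 * ((n + round (z.re / 2) : ℤ) : ℂ))⁻¹‖ ^ 2 ≤
      (if n = 0 then 16 else 0) + 1 / (n : ℝ) ^ 2 := by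
    intro n
    refine (norm_inv_sq_le z n).trans (add_le_add_left ?_ _)
    split_ifs
    exacts [hC, le_rfl]
  exact hasSum_le hle hs2.hasSum hsum

/-- With `t` running through odd numbers, the right hand side telescopes. It equals
`2 / ((t + h)² - 1)`, and `(t + h)² - 1 ≤ 2 (t² + h²)`. -/
lemma inv_sq_le_telescope {w : ℂ} {h t : ℝ} (hh : 1 / 2 ≤ h) (ht : 1 ≤ t) (hw : h ≤ |w.im|)
    (hr : t ≤ |w.re|) : ‖w⁻¹‖ ^ 2 ≤ 1 / (t - 1 + h) - 1 / (t + 1 + h) := by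
  have h1 : t ^ 2 + h ^ 2 ≤ ‖w‖ ^ 2 := by
    rw [Complex.sq_norm, Complex.normSq_apply, ← sq, ← sq, ← sq_abs w.re, ← sq_abs w.im]
    gcongr
  have e : 1 / (t - 1 + h) - 1 / (t + 1 + h) = 2 / ((t - 1 + h) * (t + 1 + h)) := by
    field_simp [show t - 1 + h ≠ 0 by linarith, show t + 1 + h ≠ 0 by linarith]
    ring
  have hp : 0 < (t - 1 + h) * (t + 1 + h) := mul_pos (by linarith) (by linarith)
  have hq : 0 < t ^ 2 + h ^ 2 := by positivity
  rw [e, norm_inv, inv_pow, ← one_div]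
  calc 1 / ‖w‖ ^ 2 ≤ 1 / (t ^ 2 + h ^ 2) := by gcongr
    _ ≤ _ := by
      rw [div_le_div_iff₀ hq hp]
      nlinarith [sq_nonneg (t - h)]

lemma tsum_nat_telescope {f : ℕ → ℝ} {h : ℝ} (hh : 0 < h) (hf0 : ∀ m, 0 ≤ f m)
    (hf : ∀ m : ℕ, f m ≤ 1 / (2 * m + h) - 1 / (2 * (m + 1) + h)) : ∑' m, f m ≤ 1 / h := by
  apply Real.tsum_le_of_sum_range_le hf0
  intro n
  have h1 : ∑ m ∈ Finset.range n, (1 / (2 * (m : ℝ) + h) - 1 / (2 * ((m + 1 : ℕ) : ℝ) + h)) =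
      1 / (2 * ((0 : ℕ) : ℝ) + h) - 1 / (2 * (n : ℝ) + h) :=
    Finset.sum_range_sub' (fun m : ℕ => 1 / (2 * (m : ℝ) + h)) n
  have h2 : ∑ m ∈ Finset.range n, f m ≤
      ∑ m ∈ Finset.range n, (1 / (2 * (m : ℝ) + h) - 1 / (2 * ((m + 1 : ℕ) : ℝ) + h)) :=
    Finset.sum_le_sum fun m _ => by simpa using hf m
  rw [h1] at h2
  have h3 : 0 ≤ 1 / (2 * (n : ℝ) + h) := by positivity
  simp only [Nat.cast_zero, mul_zero, zero_add] at h2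
  linarith

/-- The nearest even integer contributes at most `h⁻² ≤ 2 / h`, those to its left and to its right
at most `1 / h` each. -/
lemma tsum_inv_sq_le_of_im {z : ℂ} {h : ℝ} (hh : 1 / 2 ≤ h) (hz : h ≤ |z.im|) :
    ∑' n : ℤ, ‖(z - 2 * n)⁻¹‖ ^ 2 ≤ 4 / h := by
  have hs := ((Equiv.addRight (round (z.re / 2))).summable_iff
    (f := fun n : ℤ => ‖(z - 2 * n)⁻¹‖ ^ 2)).2 (summable_inv_sq z)
  rw [tsum_inv_sq_shift]
  have him : ∀ n : ℤ, h ≤ |(z - 2 * ((n + round (z.re / 2) : ℤ) : ℂ)).im| := by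
    intro n
    simpa using hz
  set F : ℤ → ℝ := fun n => ‖(z - 2 * ((n + round (z.re / 2) : ℤ) : ℂ))⁻¹‖ ^ 2 with hF
  have hsF : Summable F := hs
  have hs1 : Summable fun m : ℕ => F m :=
    hsF.comp_injective (i := fun m : ℕ => (m : ℤ)) Nat.cast_injective
  have hs2 : Summable fun m : ℕ => F (-(m + 1)) :=
    hsF.comp_injective (i := fun m : ℕ => (-(m + 1) : ℤ)) fun a b hab => by
      have : (-((a : ℤ) + 1)) = -((b : ℤ) + 1) := hab
      omega
  have hterm : ∀ (n : ℤ) (m : ℕ), |(n : ℝ)| = m + 1 →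
      F n ≤ 1 / (2 * m + h) - 1 / (2 * (m + 1) + h) := by
    intro n m hn
    have h1 := abs_re_sub_ge z n
    rw [hn] at h1
    have h2 := inv_sq_le_telescope (t := 2 * ((m : ℝ) + 1) - 1) hh
      (by linarith [m.cast_nonneg (α := ℝ)]) (him n) h1
    refine h2.trans_eq ?_
    congr 2 <;> ring
  have hF0 : F 0 ≤ 2 / h := by
    have h1 : h ≤ ‖z - 2 * ((0 + round (z.re / 2) : ℤ) : ℂ)‖ :=
      (him 0).trans (Complex.abs_im_le_norm _)
    have hp : 0 < h := by linarith
    rw [hF]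
    simp only
    rw [norm_inv, inv_pow, ← one_div]
    calc _ ≤ 1 / h ^ 2 := by gcongr
      _ ≤ 2 / h := by
        rw [div_le_div_iff₀ (by positivity) hp]
        nlinarith
  rw [tsum_of_nat_of_neg_add_one hs1 hs2, hs1.tsum_eq_zero_add]
  have b1 : ∑' m : ℕ, F ((m + 1 : ℕ) : ℤ) ≤ 1 / h := by
    refine tsum_nat_telescope (by linarith) (fun _ => by positivity) fun m => hterm _ m ?_
    push_cast
    rw [abs_of_nonneg (by positivity)]
  have b2 : ∑' m : ℕ, F (-(m + 1)) ≤ 1 / h := by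
    refine tsum_nat_telescope (by linarith) (fun _ => by positivity) fun m => hterm _ m ?_
    push_cast
    rw [abs_neg, abs_of_nonneg (by positivity)]
  have e : 4 / h = 2 / h + 1 / h + 1 / h := by ring
  rw [e]
  exact add_le_add (add_le_add hF0 b1) b2

/-! ### Fourier multipliers -/

/-- The `ℓ²` norm of the sequence `1 / (z - 2n)`, `n ∈ ℤ`. -/
def sig (z : ℂ) : ℝ := Real.sqrt (∑' n : ℤ, ‖(z - 2 * n)⁻¹‖ ^ 2)

lemma sig_nonneg (z : ℂ) : 0 ≤ sig z := Real.sqrt_nonneg _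

lemma sig_sq (z : ℂ) : sig z ^ 2 = ∑' n : ℤ, ‖(z - 2 * n)⁻¹‖ ^ 2 :=
  Real.sq_sqrt (tsum_nonneg fun _ => by positivity)

lemma norm_multiplier_term_le (z : ℂ) (g : L2) (n : ℤ) :
    ‖((z - 2 * n)⁻¹ * inner ℂ (expFun (2 * n)) g) • expB n‖ ≤
      ‖(z - 2 * n)⁻¹‖ * ‖(inner ℂ (expFun (2 * n)) g : ℂ)‖ := by
  rw [norm_smul, norm_mul]
  exact mul_le_of_le_one_right (by positivity) (norm_expB_le n)

lemma sum_multiplier_le (z : ℂ) (g : L2) (s : Finset ℤ) :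
    ∑ n ∈ s, ‖(z - 2 * n)⁻¹‖ * ‖(inner ℂ (expFun (2 * n)) g : ℂ)‖ ≤ sig z * ‖g‖ := by
  refine (Real.sum_mul_le_sqrt_mul_sqrt s _ _).trans ?_
  have h := hasSum_norm_inner_sq g
  have h1 := Real.sqrt_le_sqrt
    ((summable_inv_sq z).sum_le_tsum s fun _ _ => by positivity)
  have h2 := Real.sqrt_le_sqrt (h.summable.sum_le_tsum s fun _ _ => by positivity)
  rw [h.tsum_eq, Real.sqrt_sq (norm_nonneg g)] at h2
  exact mul_le_mul h1 h2 (Real.sqrt_nonneg _) (Real.sqrt_nonneg _)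

lemma summable_multiplier (z : ℂ) (g : L2) :
    Summable fun n : ℤ => ‖(z - 2 * n)⁻¹‖ * ‖(inner ℂ (expFun (2 * n)) g : ℂ)‖ :=
  summable_of_sum_le (fun _ => by positivity) (sum_multiplier_le z g)

lemma summable_multiplier_term (z : ℂ) (g : L2) :
    Summable fun n : ℤ => ((z - 2 * n)⁻¹ * inner ℂ (expFun (2 * n)) g) • expB n :=
  Summable.of_norm_bounded (summable_multiplier z g) (norm_multiplier_term_le z g)

/-- The Fourier multiplier `1 / (z - 2n)`: the inverse of `z + i d/dx` on `π`-periodic functions,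
as an operator from `L²([0, π])` to bounded continuous functions. -/
def multB (z : ℂ) : L2 →L[ℂ] Cb :=
  LinearMap.mkContinuous
    { toFun := fun g => ∑' n : ℤ, ((z - 2 * n)⁻¹ * inner ℂ (expFun (2 * n)) g) • expB n
      map_add' := fun f g => by
        rw [← (summable_multiplier_term z f).tsum_add (summable_multiplier_term z g)]
        congr 1
        ext1 n
        rw [inner_add_right, mul_add, add_smul]
      map_smul' := fun c g => by
        rw [RingHom.id_apply, ← (summable_multiplier_term z g).tsum_const_smul c]
        congr 1
        ext1 n
        rw [inner_smul_right, smul_smul]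
        congr 1
        ring } (sig z) (by
    intro g
    refine (tsum_of_norm_bounded (summable_multiplier z g).hasSum
      (norm_multiplier_term_le z g)).trans ?_
    exact (summable_multiplier z g).tsum_le_of_sum_le (sum_multiplier_le z g))

lemma norm_multB_le (z : ℂ) (g : L2) : ‖multB z g‖ ≤ sig z * ‖g‖ :=
  (multB z).le_of_opNorm_le (LinearMap.mkContinuous_norm_le _ (sig_nonneg z) _) g

lemma multB_expFun (z : ℂ) (k : ℤ) : multB z (expFun (2 * k)) = (z - 2 * k)⁻¹ • expB k := by
  change ∑' n : ℤ, ((z - 2 * n)⁻¹ * inner ℂ (expFun (2 * n)) (expFun (2 * k))) • expB n = _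
  have h := orthonormal_iff_ite.1 orthonormal_expFun
  rw [tsum_eq_single k]
  · rw [h k k]
    simp
  · intro n hn
    rw [h n k]
    simp [hn]

/-- The Fourier multiplier `1 / (z - 2n)` as an operator in `L²([0, π])`. -/
def mult (z : ℂ) : L2 →L[ℂ] L2 := toL2 ∘L multB z

lemma mult_expFun (z : ℂ) (k : ℤ) : mult z (expFun (2 * k)) = (z - 2 * k)⁻¹ • expFun (2 * k) := by
  rw [mult, ContinuousLinearMap.comp_apply, multB_expFun, map_smul, toL2_expB]

/-! ### Sobolev functions -/

lemma zero_mem_Icc : (0 : ℝ) ∈ Icc 0 Real.pi := ⟨le_rfl, Real.pi_pos.le⟩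

lemma pi_mem_Icc : Real.pi ∈ Icc 0 Real.pi := ⟨Real.pi_pos.le, le_rfl⟩

lemma intervalIntegral_congr_muI {f g : ℝ → ℂ} (h : f =ᵐ[muI] g) {x : ℝ}
    (hx : x ∈ Icc 0 Real.pi) : ∫ t in (0 : ℝ)..x, f t = ∫ t in (0 : ℝ)..x, g t := by
  rw [intervalIntegral.integral_of_le hx.1, intervalIntegral.integral_of_le hx.1]
  apply integral_congr_ae
  exact ae_mono (Measure.restrict_mono
    (fun t ht => ⟨ht.1.le, ht.2.trans hx.2⟩ : Ioc 0 x ⊆ Icc 0 Real.pi) le_rfl) (ae_muI.1 h)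

/-- The primitive `f ↦ ∫₀ˣ f` at a point `x ∈ [0, π]` is a bounded functional on `L²`. -/
lemma exists_primitive_functional {x : ℝ} (hx : x ∈ Icc 0 Real.pi) :
    ∃ J : L2 →L[ℂ] ℂ, ∀ f : L2, J f = ∫ t in (0 : ℝ)..x, f t := by
  have hm : MemLp ((Ioc 0 x).indicator fun _ : ℝ => (Real.pi : ℂ)) 2 muI :=
    memLp_indicator_const 2 measurableSet_Ioc _ (Or.inr (measure_ne_top _ _))
  refine ⟨innerSL ℂ (hm.toLp _), fun f => ?_⟩
  rw [innerSL_apply_apply, L2.inner_def]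
  have h1 : ∫ t, inner ℂ ((hm.toLp _ : L2) t) (f t) ∂muI =
      ∫ t, (Ioc 0 x).indicator (fun t => Real.pi * f t) t ∂muI := by
    apply integral_congr_ae
    filter_upwards [hm.coeFn_toLp] with t ht
    rw [ht]
    by_cases h : t ∈ Ioc 0 x <;> simp [h, mul_comm]
  have hπ := Complex.ofReal_ne_zero.2 Real.pi_ne_zero
  rw [h1, integral_muI, intervalIntegral.integral_of_le Real.pi_pos.le,
    setIntegral_indicator measurableSet_Ioc, intervalIntegral.integral_of_le hx.1,
    Ioc_inter_Ioc, max_self, min_eq_right hx.2, integral_const_mul]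
  field_simp

lemma IsH1.reflect {u : ℝ → ℂ} {f f' : L2} (h : IsH1 u f f') :
    IsH1 (fun x => u (Real.pi - x)) (reflect f) (-reflect f') := by
  refine ⟨?_, fun x hx => ?_⟩
  · filter_upwards [coeFn_reflect f, ae_reflect h.1] with x h1 h2
    rw [h1, h2]
  · have hx' : Real.pi - x ∈ Icc 0 Real.pi := ⟨by linarith [hx.2], by linarith [hx.1]⟩
    have e : (-Dirac.reflect f' : L2) =ᵐ[muI] fun t => -f' (Real.pi - t) := by
      filter_upwards [Lp.coeFn_neg (Dirac.reflect f'), coeFn_reflect f'] with t h1 h2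
      rw [h1, Pi.neg_apply, h2]
    rw [intervalIntegral_congr_muI e hx, intervalIntegral.integral_neg,
      intervalIntegral.integral_comp_sub_left (fun t => f' t) Real.pi]
    simp only [sub_zero]
    rw [h.2 _ hx', h.2 _ pi_mem_Icc,
      ← intervalIntegral.integral_add_adjacent_intervals (b := Real.pi - x)
        (intervalIntegrable_L2 f' zero_mem_Icc hx') (intervalIntegrable_L2 f' hx' pi_mem_Icc)]
    ring

/-- The function `multB z g` solves `z u + i u' = g`. Here it is multiplied by a smooth function
`h`, and the product rule is included. Both sides of the identity to be checked depend
continuously on `g ∈ L²`, so the case of exponentials suffices. -/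
lemma isH1_mul_multB {z : ℂ} (hz : ∀ n : ℤ, z - 2 * n ≠ 0) (g : L2) {h h' : ℝ → ℂ}
    (hh : Continuous h) (hh' : Continuous h') (hd : ∀ x, HasDerivAt h (h' x) x) :
    IsH1 (fun x => h x * multB z g x) (mulOp h hh (mult z g))
      (mulOp h hh ((Complex.I * z) • mult z g - Complex.I • g) + mulOp h' hh' (mult z g)) := by
  refine ⟨?_, fun x hx => ?_⟩
  · filter_upwards [coeFn_mulOp h hh (mult z g), coeFn_toL2 (multB z g)] with x h1 h2
    rw [h1]
    exact congrArg _ h2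
  · obtain ⟨J, hJ⟩ := exists_primitive_functional hx
    rw [← hJ]
    let ev (t : ℝ) : L2 →L[ℂ] ℂ := BoundedContinuousFunction.evalCLM ℂ t ∘L multB z
    have key : h x • ev x = h 0 • ev 0 + J ∘L (mulOp h hh ∘L ((Complex.I * z) • mult z -
        Complex.I • ContinuousLinearMap.id ℂ L2) + mulOp h' hh' ∘L mult z) := by
      apply clm_ext_expFun
      intro k
      have hk := hz k
      have hev : ∀ t, ev t (expFun (2 * k)) = (z - 2 * k)⁻¹ * expB k t := by
        intro t
        change multB z (expFun (2 * k)) t = _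
        rw [multB_expFun]
        rfl
      simp only [add_apply, smul_apply,
        ContinuousLinearMap.comp_apply, sub_apply,
        ContinuousLinearMap.id_apply, hev, mult_expFun]
      have e : mulOp h hh ((Complex.I * z) • (z - 2 * (k : ℂ))⁻¹ • expFun (2 * k) -
          Complex.I • expFun (2 * k)) + mulOp h' hh' ((z - 2 * (k : ℂ))⁻¹ • expFun (2 * k)) =
          (z - 2 * (k : ℂ))⁻¹ • (mulOp h hh ((2 * Complex.I * k) • expFun (2 * k)) +
            mulOp h' hh' (expFun (2 * k))) := by
        have : (Complex.I * z) • (z - 2 * (k : ℂ))⁻¹ • expFun (2 * k) -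
            Complex.I • expFun (2 * k) =
            (z - 2 * (k : ℂ))⁻¹ • ((2 * Complex.I * k) • expFun (2 * k)) := by
          rw [smul_smul, smul_smul, ← sub_smul]
          congr 1
          field_simp
          ring
        rw [this]
        simp only [map_smul, smul_add]
      rw [e, map_smul, hJ]
      have e2 : (mulOp h hh ((2 * Complex.I * k) • expFun (2 * k)) +
          mulOp h' hh' (expFun (2 * k)) : L2) =ᵐ[muI]
          fun t => h' t * expB k t + h t * (2 * Complex.I * k * expB k t) := by
        filter_upwards [Lp.coeFn_add (mulOp h hh ((2 * Complex.I * k) • expFun (2 * k)))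
          (mulOp h' hh' (expFun (2 * k))), coeFn_mulOp h hh ((2 * Complex.I * k) • expFun (2 * k)),
          coeFn_mulOp h' hh' (expFun (2 * k)), Lp.coeFn_smul (2 * Complex.I * k : ℂ)
          (expFun (2 * k)), coeFn_expFun (2 * k)] with t h1 h2 h3 h4 h5
        rw [h1, Pi.add_apply, h2, h3, h4, Pi.smul_apply, h5, expB_apply, smul_eq_mul]
        ring
      have hder : ∀ t ∈ uIcc 0 x, HasDerivAt (fun t : ℝ => h t * expB k t)
          (h' t * expB k t + h t * (2 * Complex.I * k * expB k t)) t := by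
        intro t _
        refine (hd t).mul ?_
        have h1 : HasDerivAt (fun t : ℝ => Complex.I * ((2 * k : ℤ) : ℂ) * (t : ℂ))
            (Complex.I * ((2 * k : ℤ) : ℂ)) t := by
          simpa using (Complex.ofRealCLM.hasDerivAt (x := t)).const_mul
            (Complex.I * ((2 * k : ℤ) : ℂ))
        have h2 := h1.cexp
        rw [show 2 * Complex.I * k * expB k t = Complex.exp (Complex.I * ((2 * k : ℤ) : ℂ) * t) *
          (Complex.I * ((2 * k : ℤ) : ℂ)) by rw [expB_apply]; push_cast; ring]
        exact h2
      have hB := (expB k).continuous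
      rw [intervalIntegral_congr_muI e2 hx, intervalIntegral.integral_eq_sub_of_hasDerivAt hder
        (Continuous.intervalIntegrable (by fun_prop) _ _)]
      simp only [smul_eq_mul]
      ring
    exact congrArg (fun L : L2 →L[ℂ] ℂ => L g) key

lemma multB_periodic (z : ℂ) (g : L2) : multB z g Real.pi = multB z g 0 := by
  have key : BoundedContinuousFunction.evalCLM ℂ Real.pi ∘L multB z =
      BoundedContinuousFunction.evalCLM ℂ 0 ∘L multB z := by
    apply clm_ext_expFun
    intro k
    change multB z (expFun (2 * k)) Real.pi = multB z (expFun (2 * k)) 0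
    rw [multB_expFun]
    change _ * expB k Real.pi = _ * expB k 0
    rw [expB_apply, expB_apply]
    congr 1
    rw [Complex.exp_eq_exp_iff_exists_int]
    exact ⟨k, by push_cast; ring⟩
  exact congrArg (fun L : L2 →L[ℂ] ℂ => L g) key

lemma IsH1.continuousOn {u : ℝ → ℂ} {f f' : L2} (h : IsH1 u f f') :
    ContinuousOn u (Icc 0 Real.pi) := by
  have h1 := intervalIntegral.continuousOn_primitive_interval'
    (intervalIntegrable_L2 f' zero_mem_Icc pi_mem_Icc) Set.left_mem_uIcc
  rw [Set.uIcc_of_le Real.pi_pos.le] at h1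
  exact (continuousOn_const.add h1).congr h.2

lemma IsH1.exists_bounded {u : ℝ → ℂ} {f f' : L2} (h : IsH1 u f f') :
    ∃ w : Cb, ∀ x ∈ Icc 0 Real.pi, w x = u x := by
  refine ⟨(BoundedContinuousFunction.mkOfCompact ⟨fun x : Icc 0 Real.pi => u x,
    continuousOn_iff_continuous_domRestrict.1 h.continuousOn⟩).compContinuous
    ⟨projIcc 0 Real.pi Real.pi_pos.le, continuous_projIcc⟩, fun x hx => ?_⟩
  simp [projIcc_of_mem Real.pi_pos.le hx]
  rfl

/-- A solution of `u' = c u` in the Sobolev space is an exponential. -/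
lemma IsH1.eq_exp {u : ℝ → ℂ} {f f' : L2} {c : ℂ} (h : IsH1 u f f')
    (hc : ∀ᵐ x ∂muI, f' x = c * f x) :
    ∀ x ∈ Icc 0 Real.pi, u x = u 0 * Complex.exp (c * x) := by
  obtain ⟨w, hw⟩ := h.exists_bounded
  have hF : ∀ x ∈ Icc 0 Real.pi, u x = u 0 + ∫ t in (0 : ℝ)..x, c * w t := by
    intro x hx
    rw [h.2 x hx]
    congr 1
    apply intervalIntegral_congr_muI _ hx
    filter_upwards [hc, h.1, ae_mem_Icc] with t h1 h2 h3
    rw [h1, h2, hw t h3]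
  have hcont : Continuous fun t => c * w t := by
    have := w.continuous
    fun_prop
  have hd : ∀ x : ℝ, HasDerivAt (fun x => (u 0 + ∫ t in (0 : ℝ)..x, c * w t) *
      Complex.exp (-(c * x))) (c * w x * Complex.exp (-(c * x)) +
        (u 0 + ∫ t in (0 : ℝ)..x, c * w t) * (Complex.exp (-(c * x)) * -c)) x := by
    intro x
    refine HasDerivAt.mul ?_ ?_
    · exact (intervalIntegral.integral_hasDerivAt_right (hcont.intervalIntegrable _ _)
        (hcont.stronglyMeasurableAtFilter _ _) hcont.continuousAt).const_add _
    · have h1 : HasDerivAt (fun t : ℝ => -(c * (t : ℂ))) (-c) x := by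
        simpa using ((Complex.ofRealCLM.hasDerivAt (x := x)).const_mul c).fun_neg
      exact h1.cexp
  have hconst := constant_of_has_deriv_right_zero (a := 0) (b := Real.pi)
    (fun x _ => (hd x).continuousAt.continuousWithinAt) (fun x hx => by
      have h1 := (hd x).hasDerivWithinAt (s := Ici x)
      have h2 := hF x (Ico_subset_Icc_self hx)
      rw [← h2, ← hw x (Ico_subset_Icc_self hx)] at h1
      convert h1 using 1
      ring)
  intro x hx
  have h1 := hconst x hx
  simp only [intervalIntegral.integral_same, add_zero, Complex.ofReal_zero, mul_zero, neg_zero,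
    Complex.exp_zero, mul_one] at h1
  rw [← hF x hx] at h1
  rw [← h1, mul_assoc, ← Complex.exp_add]
  simp

/-! ### Algebra of the boundary conditions -/

/-- The boundary conditions solved for `u₁(0)` and `u₂(π)`, which is possible by `|A₁₄| ≠ 0`. -/
lemma satisfiesBC_iff {M : Matrix (Fin 2) (Fin 4) ℂ} (hreg : IsRegular M) (u₁ u₂ : ℝ → ℂ) :
    SatisfiesBC M u₁ u₂ ↔
      u₁ 0 + bcb M * u₁ Real.pi + bca M * u₂ 0 = 0 ∧
      bcd M * u₁ Real.pi + bcc M * u₂ 0 + u₂ Real.pi = 0 := by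
  have hdet : IsUnit (M.submatrix id ![0, 3]).det := isUnit_iff_ne_zero.2 hreg.1
  have e1 : M.mulVec ![u₁ 0, u₁ Real.pi, u₂ 0, u₂ Real.pi] =
      (M.submatrix id ![0, 3]).mulVec (![u₁ 0, u₂ Real.pi] +
        (bcMatrix M).mulVec ![u₁ Real.pi, u₂ 0]) := by
    rw [Matrix.mulVec_add, Matrix.mulVec_mulVec, bcMatrix, ← Matrix.mul_assoc,
      Matrix.mul_nonsing_inv _ hdet, Matrix.one_mul]
    ext i
    fin_cases i <;> simp [Matrix.mulVec, dotProduct, Fin.sum_univ_four] <;> ring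
  have e2 : SatisfiesBC M u₁ u₂ ↔
      ![u₁ 0, u₂ Real.pi] + (bcMatrix M).mulVec ![u₁ Real.pi, u₂ 0] = 0 := by
    rw [SatisfiesBC, e1]
    constructor
    · intro h
      have := congrArg (M.submatrix id ![0, 3])⁻¹.mulVec h
      rwa [Matrix.mulVec_mulVec, Matrix.nonsing_inv_mul _ hdet, Matrix.one_mulVec,
        Matrix.mulVec_zero] at this
    · intro h
      rw [h, Matrix.mulVec_zero]
  rw [e2, funext_iff, Fin.forall_fin_two]
  simp only [Matrix.mulVec, dotProduct, Fin.sum_univ_two, bca, bcb, bcc, bcd, Pi.add_apply,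
    Pi.zero_apply, Matrix.cons_val_zero, Matrix.cons_val_one]
  constructor
  · rintro ⟨h1, h2⟩
    exact ⟨by rw [← h1]; ring, by rw [← h2]; ring⟩
  · rintro ⟨h1, h2⟩
    exact ⟨by rw [← h1]; ring, by rw [← h2]; ring⟩

/-- The entries of `bcMatrix` through the minors. -/
lemma bcMatrix_entries {M : Matrix (Fin 2) (Fin 4) ℂ} (hreg : IsRegular M) :
    colMinor M 0 3 * bcb M = colMinor M 1 3 ∧ colMinor M 0 3 * bcc M = colMinor M 0 2 ∧
    colMinor M 0 3 * (bcb M * bcc M - bca M * bcd M) = colMinor M 1 2 := by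
  have hD := hreg.1
  refine ⟨?_, ?_, ?_⟩ <;>
  · simp only [colMinor, Matrix.det_fin_two, Matrix.submatrix_apply, id_eq, Matrix.cons_val_zero,
      Matrix.cons_val_one, bcb, bcc, bca, bcd, bcMatrix, Matrix.inv_def,
      Matrix.adjugate_fin_two, Matrix.mul_apply, Fin.sum_univ_two, Matrix.smul_apply,
      Matrix.of_apply, smul_eq_mul, Ring.inverse_eq_inv'] at hD ⊢
    field_simp
    ring

/-- The relations between the boundary conditions and the root vectors `α`, `β`: the double
eigenvalue of `[[b, a], [d, c]]` is `-exp (iπτ)`, the root functions satisfy the boundary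
conditions, and the isomorphism `A` has nonzero determinant. -/
structure RootData (M : Matrix (Fin 2) (Fin 4) ℂ) (κ τ : ℂ) (α β : Fin 2 → ℂ) : Prop where
  norm_le : ‖κ‖ ≤ 1
  trace : bcb M + bcc M = -2 * Complex.exp (Complex.I * Real.pi * τ)
  det : bcb M * bcc M - bca M * bcd M = Complex.exp (Complex.I * Real.pi * τ) ^ 2
  indep : α 0 * β 1 - α 1 * (β 0 - κ * Real.pi * α 0) ≠ 0
  eig_fst : (Complex.exp (Complex.I * Real.pi * τ) + bcb M) * α 0 + bca M * α 1 = 0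
  eig_snd : bcd M * α 0 + (Complex.exp (Complex.I * Real.pi * τ) + bcc M) * α 1 = 0
  assoc_fst : Complex.exp (Complex.I * Real.pi * τ) * β 0 +
    bcb M * (β 0 - κ * Real.pi * α 0) + bca M * β 1 = 0
  assoc_snd : bcd M * (β 0 - κ * Real.pi * α 0) + bcc M * β 1 +
    Complex.exp (Complex.I * Real.pi * τ) * (β 1 + κ * Real.pi * α 1) = 0

open Classical in
lemma rootData {M : Matrix (Fin 2) (Fin 4) ℂ} (hreg : IsRegular M) (hns : ¬ IsStrictlyRegular M)
    {τ : ℂ} {α β : Fin 2 → ℂ} (hτ : IsExponent M τ) (hαβ : IsRootPair M α β) :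
    RootData M (if IsPeriodicType M then 0 else 1) τ α β := by
  obtain ⟨e1, e2, e3⟩ := bcMatrix_entries hreg
  have hD := hreg.1
  have hE := hreg.2
  have hdisc : (bcb M + bcc M) ^ 2 = 4 * (bcb M * bcc M - bca M * bcd M) := by
    have h : (colMinor M 0 2 + colMinor M 1 3) ^ 2 = 4 * colMinor M 0 3 * colMinor M 1 2 := by
      by_contra h
      exact hns ⟨hreg, h⟩
    rw [← e1, ← e2, ← e3] at h
    have h2 : colMinor M 0 3 ^ 2 * ((bcb M + bcc M) ^ 2) =
        colMinor M 0 3 ^ 2 * (4 * (bcb M * bcc M - bca M * bcd M)) := by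
      linear_combination h
    exact mul_left_cancel₀ (pow_ne_zero 2 hD) h2
  have htr : bcb M + bcc M = -2 * Complex.exp (Complex.I * Real.pi * τ) := by
    linear_combination -2 * hτ.1
  have hz0 : Complex.exp (Complex.I * Real.pi * τ) ≠ 0 := Complex.exp_ne_zero _
  have hπ := Complex.ofReal_ne_zero.2 Real.pi_ne_zero
  obtain ⟨hp, h0, h1⟩ := hαβ
  set z := Complex.exp (Complex.I * Real.pi * τ) with hz
  set a := bca M
  set b := bcb M
  set c := bcc M
  set d := bcd M
  have hdet : b * c - a * d = z ^ 2 := by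
    rw [htr] at hdisc
    linear_combination -(1 / 4) * hdisc
  by_cases hper : IsPeriodicType M
  · rw [if_pos hper]
    obtain ⟨hbc, ha, hd⟩ := hper
    have hc : c = -z := by
      change b = c at hbc
      linear_combination (htr - hbc) / 2
    have hb : b = -z := by
      rw [← hc]
      exact hbc
    have hli := (hp ⟨hbc, ha, hd⟩)
    change a = 0 at ha
    change d = 0 at hd
    have hne : α 0 * β 1 - α 1 * β 0 ≠ 0 := by
      intro h
      have h2 : (Matrix.of ![α, β]).det = 0 := by
        rw [Matrix.det_fin_two]
        simpa [mul_comm] using h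
      have h3 := (Matrix.linearIndependent_rows_iff_isUnit (A := Matrix.of ![α, β])).1 hli
      rw [Matrix.isUnit_iff_isUnit_det, h2] at h3
      simp at h3
    refine ⟨by simp, htr, hdet, by simpa using hne, ?_, ?_, ?_, ?_⟩ <;>
      simp [← hz, show bca M = 0 from ha, show bcd M = 0 from hd,
        show bcb M = -z from hb, show bcc M = -z from hc]
  · rw [if_neg hper]
    by_cases ha : a = 0
    · obtain ⟨rfl, rfl⟩ := h0 hper ha
      have hbc : b = c := by
        have : (b - c) ^ 2 = 0 := by
          rw [ha] at hdisc
          linear_combination hdisc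
        exact sub_eq_zero.1 (pow_eq_zero_iff two_ne_zero |>.1 this)
      have hd : d ≠ 0 := fun hd => hper ⟨hbc, ha, hd⟩
      have hc : c = -z := by linear_combination (htr - hbc) / 2
      have hb : b = -z := hbc.trans hc
      refine ⟨by simp, htr, hdet, ?_, ?_, ?_, ?_, ?_⟩
      · change 0 * 0 - d * (Real.pi * b - 1 * Real.pi * 0) ≠ 0
        have : -(d * Real.pi * -z) ≠ 0 :=
          neg_ne_zero.2 (mul_ne_zero (mul_ne_zero hd hπ) (neg_ne_zero.2 hz0))
        rw [← hb] at this
        convert this using 1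
        ring
      · change (z + b) * 0 + a * d = 0
        rw [ha]
        ring
      · change d * 0 + (z + c) * d = 0
        rw [hc]
        ring
      · change z * (Real.pi * b) + b * (Real.pi * b - 1 * Real.pi * 0) + a * 0 = 0
        rw [hb]
        ring
      · change d * (Real.pi * b - 1 * Real.pi * 0) + c * 0 + z * (0 + 1 * Real.pi * d) = 0
        rw [hb]
        ring
    · obtain ⟨rfl, rfl⟩ := h1 hper ha
      refine ⟨by simp, htr, hdet, ?_, ?_, ?_, ?_, ?_⟩
      · have e : a * (Real.pi * b) - (c - b) / 2 * (0 - 1 * Real.pi * a) = -(Real.pi * a * z) := by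
          linear_combination (Real.pi * a / 2 : ℂ) * htr
        have : -((Real.pi : ℂ) * a * z) ≠ 0 := neg_ne_zero.2 (mul_ne_zero (mul_ne_zero hπ ha) hz0)
        rw [← e] at this
        exact this
      · change (z + b) * a + a * ((c - b) / 2) = 0
        linear_combination (a / 2) * htr
      · change d * a + (z + c) * ((c - b) / 2) = 0
        linear_combination -hdet + (c / 2 - z / 2) * htr
      · change z * 0 + b * (0 - 1 * Real.pi * a) + a * (Real.pi * b) = 0
        ring
      · change d * (0 - 1 * Real.pi * a) + c * (Real.pi * b) +
          z * (Real.pi * b + 1 * Real.pi * ((c - b) / 2)) = 0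
        linear_combination Real.pi * hdet + (Real.pi * z / 2 : ℂ) * htr

/-! ### The isomorphism `A` -/

/-- The combination `a e^{iτx} f + (b + κ a x) e^{iτx} g`. Both components of `A (f, g)` have this
form, the first one up to a reflection. -/
def rowFun (κ τ a b : ℂ) (f g : L2) : L2 :=
  mulOp (fun x => a * Complex.exp (Complex.I * τ * x)) (by fun_prop) f +
    mulOp (fun x => (b + κ * a * x) * Complex.exp (Complex.I * τ * x)) (by fun_prop) g

lemma coeFn_rowFun (κ τ a b : ℂ) (f g : L2) : rowFun κ τ a b f g =ᵐ[muI] fun x : ℝ =>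
    (a * f x + (b + κ * a * x) * g x) * Complex.exp (Complex.I * τ * x) := by
  unfold rowFun
  filter_upwards [Lp.coeFn_add (mulOp (fun x => a * Complex.exp (Complex.I * τ * x))
    (by fun_prop) f) (mulOp (fun x => (b + κ * a * x) * Complex.exp (Complex.I * τ * x))
    (by fun_prop) g), coeFn_mulOp (fun x => a * Complex.exp (Complex.I * τ * x)) (by fun_prop) f,
    coeFn_mulOp (fun x => (b + κ * a * x) * Complex.exp (Complex.I * τ * x)) (by fun_prop) g]
    with x h1 h2 h3
  rw [h1, Pi.add_apply, h2, h3]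
  ring

lemma reflect_reflect (f : L2) : reflect (reflect f) = f := by
  apply Lp.ext
  filter_upwards [coeFn_reflect (reflect f), ae_reflect (coeFn_reflect f)] with x h1 h2
  rw [h1, h2, sub_sub_cancel]

lemma basisOpAux_snd (κ τ : ℂ) (α β : Fin 2 → ℂ) (y : H) :
    (basisOpAux κ τ α β y).snd = rowFun κ τ (α 1) (β 1) y.fst y.snd := rfl

lemma basisOpAux_fst (κ τ : ℂ) (α β : Fin 2 → ℂ) (y : H) :
    (basisOpAux κ τ α β y).fst =
      reflect (rowFun κ τ (α 0) (β 0 - κ * Real.pi * α 0) y.fst y.snd) := by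
  have e : (basisOpAux κ τ α β y).fst =
      mulOp (fun x => α 0 * Complex.exp (Complex.I * τ * (Real.pi - x))) (by fun_prop)
        (reflect y.fst) +
      mulOp (fun x => (β 0 - κ * α 0 * x) * Complex.exp (Complex.I * τ * (Real.pi - x)))
        (by fun_prop) (reflect y.snd) := rfl
  rw [e]
  apply Lp.ext
  filter_upwards [Lp.coeFn_add
    (mulOp (fun x => α 0 * Complex.exp (Complex.I * τ * (Real.pi - x))) (by fun_prop)
      (reflect y.fst))
    (mulOp (fun x => (β 0 - κ * α 0 * x) * Complex.exp (Complex.I * τ * (Real.pi - x)))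
      (by fun_prop) (reflect y.snd)),
    coeFn_mulOp (fun x => α 0 * Complex.exp (Complex.I * τ * (Real.pi - x))) (by fun_prop)
      (reflect y.fst),
    coeFn_mulOp (fun x => (β 0 - κ * α 0 * x) * Complex.exp (Complex.I * τ * (Real.pi - x)))
      (by fun_prop) (reflect y.snd), coeFn_reflect y.fst, coeFn_reflect y.snd,
    coeFn_reflect (rowFun κ τ (α 0) (β 0 - κ * Real.pi * α 0) y.fst y.snd),
    ae_reflect (coeFn_rowFun κ τ (α 0) (β 0 - κ * Real.pi * α 0) y.fst y.snd)]
    with x h1 h2 h3 h4 h5 h6 h7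
  rw [h1, Pi.add_apply, h2, h3, h4, h5, h6, h7]
  push_cast
  ring

lemma rowFun_mulB (κ τ a b : ℂ) (h : Cb) (f g : L2) :
    rowFun κ τ a b (mulB h f) (mulB h g) = mulB h (rowFun κ τ a b f g) := by
  apply Lp.ext
  filter_upwards [coeFn_rowFun κ τ a b (mulB h f) (mulB h g), coeFn_rowFun κ τ a b f g,
    coeFn_mulB h f, coeFn_mulB h g, coeFn_mulB h (rowFun κ τ a b f g)] with x h1 h2 h3 h4 h5
  rw [h1, h5, h2, h3, h4]
  ring

lemma reflect_mulB (h : Cb) (f : L2) : reflect (mulB h f) = mulB (reflB h) (reflect f) := by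
  apply Lp.ext
  filter_upwards [coeFn_reflect (mulB h f), ae_reflect (coeFn_mulB h f),
    coeFn_mulB (reflB h) (reflect f), coeFn_reflect f] with x h1 h2 h3 h4
  rw [h1, h2, h3, h4, reflB_apply]

/-- A linear system with rows as in `rowFun` and constant nonzero determinant is solvable. -/
lemma exists_rowFun_eq (κ τ a₁ b₁ a₂ b₂ : ℂ) (hδ : a₁ * b₂ - a₂ * b₁ ≠ 0) (s t : L2) :
    ∃ f g : L2, rowFun κ τ a₁ b₁ f g = s ∧ rowFun κ τ a₂ b₂ f g = t := by
  set δ := a₁ * b₂ - a₂ * b₁ with hδ'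
  let m (b a : ℂ) : L2 →L[ℂ] L2 := mulOp
    (fun x => δ⁻¹ * (b + κ * a * x) * Complex.exp (-(Complex.I * τ * x))) (by fun_prop)
  let n (a : ℂ) : L2 →L[ℂ] L2 := mulOp
    (fun x => δ⁻¹ * a * Complex.exp (-(Complex.I * τ * x))) (by fun_prop)
  have hm : ∀ (b a : ℂ) (f : L2), m b a f =ᵐ[muI] fun x : ℝ =>
    δ⁻¹ * (b + κ * a * x) * Complex.exp (-(Complex.I * τ * x)) * f x :=
    fun b a f => coeFn_mulOp _ _ f
  have hn : ∀ (a : ℂ) (f : L2), n a f =ᵐ[muI] fun x : ℝ =>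
    δ⁻¹ * a * Complex.exp (-(Complex.I * τ * x)) * f x := fun a f => coeFn_mulOp _ _ f
  have key : ∀ p q : ℂ, rowFun κ τ p q (m b₂ a₂ s - m b₁ a₁ t) (n a₁ t - n a₂ s) =ᵐ[muI]
      fun x => δ⁻¹ * (p * b₂ - q * a₂) * s x + δ⁻¹ * (q * a₁ - p * b₁) * t x := by
    intro p q
    filter_upwards [coeFn_rowFun κ τ p q (m b₂ a₂ s - m b₁ a₁ t) (n a₁ t - n a₂ s), hm b₂ a₂ s,
      hm b₁ a₁ t, hn a₁ t, hn a₂ s, Lp.coeFn_sub (m b₂ a₂ s) (m b₁ a₁ t),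
      Lp.coeFn_sub (n a₁ t) (n a₂ s)] with x h1 h2 h3 h4 h5 h6 h7
    rw [h1, h6, h7, Pi.sub_apply, Pi.sub_apply, h2, h3, h4, h5, Complex.exp_neg]
    have := Complex.exp_ne_zero (Complex.I * τ * x)
    field_simp
    ring
  refine ⟨m b₂ a₂ s - m b₁ a₁ t, n a₁ t - n a₂ s, ?_, ?_⟩
  · apply Lp.ext
    filter_upwards [key a₁ b₁] with x hx
    rw [hx, show a₁ * b₂ - b₁ * a₂ = δ by rw [hδ']; ring, inv_mul_cancel₀ hδ]
    ring
  · apply Lp.ext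
    filter_upwards [key a₂ b₂] with x hx
    rw [hx, show b₂ * a₁ - a₂ * b₁ = δ by rw [hδ']; ring, inv_mul_cancel₀ hδ]
    ring

lemma eq_zero_of_rowFun_eq_zero (κ τ a₁ b₁ a₂ b₂ : ℂ) (hδ : a₁ * b₂ - a₂ * b₁ ≠ 0) {f g : L2}
    (h1 : rowFun κ τ a₁ b₁ f g = 0) (h2 : rowFun κ τ a₂ b₂ f g = 0) : f = 0 ∧ g = 0 := by
  have k1 := coeFn_rowFun κ τ a₁ b₁ f g
  have k2 := coeFn_rowFun κ τ a₂ b₂ f g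
  rw [h1] at k1
  rw [h2] at k2
  have key : ∀ᵐ x ∂muI, f x = 0 ∧ g x = 0 := by
    filter_upwards [k1, k2, Lp.coeFn_zero ℂ 2 muI] with x h1 h2 h3
    rw [h3, Pi.zero_apply, eq_comm, mul_eq_zero, or_iff_left (Complex.exp_ne_zero _)] at h1 h2
    constructor
    · apply (mul_eq_zero.1 ?_).resolve_left hδ
      linear_combination (b₂ + κ * a₂ * x) * h1 - (b₁ + κ * a₁ * x) * h2
    · apply (mul_eq_zero.1 ?_).resolve_left hδ
      linear_combination a₁ * h2 - a₂ * h1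
  constructor
  · apply Lp.ext
    filter_upwards [key, Lp.coeFn_zero ℂ 2 muI] with x h1 h2
    rw [h1.1, h2]
    rfl
  · apply Lp.ext
    filter_upwards [key, Lp.coeFn_zero ℂ 2 muI] with x h1 h2
    rw [h1.2, h2]
    rfl

lemma H_ext {y w : H} (h1 : y.fst = w.fst) (h2 : y.snd = w.snd) : y = w :=
  (WithLp.equiv 2 _).injective (Prod.ext h1 h2)

lemma isInvertible_basisOpAux {κ τ : ℂ} {α β : Fin 2 → ℂ}
    (hδ : α 0 * β 1 - α 1 * (β 0 - κ * Real.pi * α 0) ≠ 0) :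
    (basisOpAux κ τ α β).IsInvertible := by
  have hinj : (basisOpAux κ τ α β).ker = ⊥ := by
    rw [LinearMap.ker_eq_bot']
    intro y hy
    change basisOpAux κ τ α β y = 0 at hy
    have h2 : rowFun κ τ (α 1) (β 1) y.fst y.snd = 0 := by
      rw [← basisOpAux_snd, hy]
      rfl
    have h1 : rowFun κ τ (α 0) (β 0 - κ * Real.pi * α 0) y.fst y.snd = 0 := by
      rw [← reflect_reflect (rowFun κ τ (α 0) (β 0 - κ * Real.pi * α 0) y.fst y.snd),
        ← basisOpAux_fst, hy]
      exact map_zero reflect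
    obtain ⟨e1, e2⟩ := eq_zero_of_rowFun_eq_zero _ _ _ _ _ _ hδ h1 h2
    exact H_ext e1 e2
  have hsurj : (basisOpAux κ τ α β).range = ⊤ := by
    rw [LinearMap.range_eq_top]
    intro w
    obtain ⟨f, g, h1, h2⟩ := exists_rowFun_eq κ τ _ _ _ _ hδ (reflect w.fst) w.snd
    refine ⟨WithLp.toLp 2 (f, g), ?_⟩
    apply H_ext
    · change (basisOpAux κ τ α β (WithLp.toLp 2 (f, g))).fst = _
      rw [basisOpAux_fst]
      change reflect (rowFun κ τ (α 0) (β 0 - κ * Real.pi * α 0) f g) = _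
      rw [h1, reflect_reflect]
    · change (basisOpAux κ τ α β (WithLp.toLp 2 (f, g))).snd = _
      rw [basisOpAux_snd]
      exact h2
  exact ⟨ContinuousLinearEquiv.ofBijective _ hinj hsurj,
    ContinuousLinearEquiv.coe_ofBijective _ hinj hsurj⟩

/-! ### The resolvent of the free operator -/

/-- First coordinate of `H`. -/
def fstH : H →L[ℂ] L2 :=
  ContinuousLinearMap.fst ℂ L2 L2 ∘L (WithLp.prodContinuousLinearEquiv 2 ℂ L2 L2 : H →L[ℂ] L2 × L2)

/-- Second coordinate of `H`. -/
def sndH : H →L[ℂ] L2 :=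
  ContinuousLinearMap.snd ℂ L2 L2 ∘L (WithLp.prodContinuousLinearEquiv 2 ℂ L2 L2 : H →L[ℂ] L2 × L2)

/-- The first component of the conjugated free resolvent. Conjugation by `A` turns the free operator
into `-i d/dx + τ` on `π`-periodic functions plus the nilpotent matrix with the entry `-iκ`. The
inverse of `z + τ` minus this operator is the pair `(solB₀, solB₁)`, with values in bounded
continuous functions. -/
def solB₀ (κ z : ℂ) : H →L[ℂ] Cb := multB z ∘L (fstH - (Complex.I * κ) • mult z ∘L sndH)

/-- The second component of the conjugated free resolvent. -/
def solB₁ (z : ℂ) : H →L[ℂ] Cb := multB z ∘L sndH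

lemma mulOp_comb {h k l : ℝ → ℂ} (hh : Continuous h) (hk : Continuous k) (hl : Continuous l)
    (c d : ℂ) (e : ∀ x, l x = c * h x + d * k x) (f : L2) :
    mulOp l hl f = c • mulOp h hh f + d • mulOp k hk f := by
  apply Lp.ext
  filter_upwards [coeFn_mulOp h hh f, coeFn_mulOp k hk f, coeFn_mulOp l hl f,
    Lp.coeFn_add (c • mulOp h hh f) (d • mulOp k hk f), Lp.coeFn_smul c (mulOp h hh f),
    Lp.coeFn_smul d (mulOp k hk f)] with x h1 h2 h3 h4 h5 h6
  rw [h3, h4, Pi.add_apply, h5, h6, Pi.smul_apply, Pi.smul_apply, h1, h2, e, smul_eq_mul,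
    smul_eq_mul]
  ring

/-- The conjugated free resolvent as an operator in `H`. -/
def freeSol (κ z : ℂ) : H →L[ℂ] H :=
  ((WithLp.prodContinuousLinearEquiv 2 ℂ L2 L2).symm : L2 × L2 →L[ℂ] H) ∘L
    (toL2 ∘L solB₀ κ z).prod (toL2 ∘L solB₁ z)

lemma freeSol_apply (κ z : ℂ) (g : H) :
    freeSol κ z g = WithLp.toLp 2 (toL2 (solB₀ κ z g), toL2 (solB₁ z g)) := rfl

/-- The rows of `A D g`, up to a reflection in the first component, with their derivatives. -/
lemma isH1_rowFun {z : ℂ} (hz : ∀ n : ℤ, z - 2 * n ≠ 0) (κ τ a b : ℂ) (g : H) :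
    IsH1 (fun x => (a * solB₀ κ z g x + (b + κ * a * x) * solB₁ z g x) *
        Complex.exp (Complex.I * τ * x))
      (rowFun κ τ a b (toL2 (solB₀ κ z g)) (toL2 (solB₁ z g)))
      ((Complex.I * (z + τ)) • rowFun κ τ a b (toL2 (solB₀ κ z g)) (toL2 (solB₁ z g)) -
        Complex.I • rowFun κ τ a b g.fst g.snd) := by
  set q : L2 := g.fst - (Complex.I * κ) • mult z g.snd with hq
  have e0 : solB₀ κ z g = multB z q := rfl
  have e1 : solB₁ z g = multB z g.snd := rfl
  have t0 : toL2 (solB₀ κ z g) = mult z q := rfl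
  have t1 : toL2 (solB₁ z g) = mult z g.snd := rfl
  have hexp : ∀ x : ℝ, HasDerivAt (fun x : ℝ => Complex.exp (Complex.I * τ * x))
      (Complex.exp (Complex.I * τ * x) * (Complex.I * τ)) x := by
    intro x
    have h1 : HasDerivAt (fun t : ℝ => Complex.I * τ * (t : ℂ)) (Complex.I * τ) x := by
      simpa using (Complex.ofRealCLM.hasDerivAt (x := x)).const_mul (Complex.I * τ)
    exact h1.cexp
  have hd0 : ∀ x : ℝ, HasDerivAt (fun x : ℝ => a * Complex.exp (Complex.I * τ * x))
      (a * (Complex.exp (Complex.I * τ * x) * (Complex.I * τ))) x :=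
    fun x => (hexp x).const_mul a
  have hd1 : ∀ x : ℝ, HasDerivAt
      (fun x : ℝ => (b + κ * a * x) * Complex.exp (Complex.I * τ * x))
      (κ * a * Complex.exp (Complex.I * τ * x) +
        (b + κ * a * x) * (Complex.exp (Complex.I * τ * x) * (Complex.I * τ))) x := by
    intro x
    refine HasDerivAt.mul ?_ (hexp x)
    simpa using ((Complex.ofRealCLM.hasDerivAt (x := x)).const_mul (κ * a)).const_add b
  have c0 : Continuous fun x : ℝ => a * (Complex.exp (Complex.I * τ * x) * (Complex.I * τ)) := by
    fun_prop
  have c1 : Continuous fun x : ℝ => κ * a * Complex.exp (Complex.I * τ * x) +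
      (b + κ * a * x) * (Complex.exp (Complex.I * τ * x) * (Complex.I * τ)) := by fun_prop
  have h := (isH1_mul_multB hz q (by fun_prop) c0 hd0).add
    (isH1_mul_multB hz g.snd (by fun_prop) c1 hd1)
  rw [← rowFun, ← t0, ← t1, ← e0, ← e1, hq, ← t1] at h
  convert h using 1
  · ext x
    simp only [Pi.add_apply]
    ring
  · rw [mulOp_comb (h := fun x : ℝ => a * Complex.exp (Complex.I * τ * x))
        (k := fun x : ℝ => a * Complex.exp (Complex.I * τ * x)) (by fun_prop) (by fun_prop) c0
        (Complex.I * τ) 0 (fun x => by ring),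
      mulOp_comb (h := fun x : ℝ => a * Complex.exp (Complex.I * τ * x))
        (k := fun x : ℝ => (b + κ * a * x) * Complex.exp (Complex.I * τ * x)) (by fun_prop)
        (by fun_prop) c1 κ (Complex.I * τ) (fun x => by ring)]
    simp only [rowFun, map_sub, map_smul, smul_sub, smul_add, smul_smul]
    have eκ : Complex.I * (Complex.I * κ) = -κ := by
      rw [← mul_assoc, Complex.I_mul_I]
      ring
    rw [eκ]
    module

/-- The vector `A D g`, where `D` is the conjugated free resolvent, lies in the domain of the free
operator, and `(z + τ) - L⁰` maps it to `A g`. -/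
lemma exists_isH1_free {M : Matrix (Fin 2) (Fin 4) ℂ} (hreg : IsRegular M) {κ τ : ℂ}
    {α β : Fin 2 → ℂ} (hd : RootData M κ τ α β) {z : ℂ} (hz : ∀ n : ℤ, z - 2 * n ≠ 0) (g : H) :
    ∃ (u₁ u₂ : ℝ → ℂ) (f₁ f₂ : L2),
      IsH1 u₁ (basisOpAux κ τ α β (freeSol κ z g)).fst f₁ ∧
      IsH1 u₂ (basisOpAux κ τ α β (freeSol κ z g)).snd f₂ ∧
      SatisfiesBC M u₁ u₂ ∧
      (z + τ) • (basisOpAux κ τ α β (freeSol κ z g)).fst - Complex.I • f₁ =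
        (basisOpAux κ τ α β g).fst ∧
      (z + τ) • (basisOpAux κ τ α β (freeSol κ z g)).snd + Complex.I • f₂ =
        (basisOpAux κ τ α β g).snd := by
  have h1 := (isH1_rowFun hz κ τ (α 0) (β 0 - κ * Real.pi * α 0) g).reflect
  have h2 := isH1_rowFun hz κ τ (α 1) (β 1) g
  refine ⟨_, _, _, _, (by rw [basisOpAux_fst]; exact h1), h2, ?_, ?_, ?_⟩
  · rw [satisfiesBC_iff hreg]
    have p0 : solB₀ κ z g Real.pi = solB₀ κ z g 0 := multB_periodic z _
    have p1 : solB₁ z g Real.pi = solB₁ z g 0 := multB_periodic z _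
    have ez : Complex.exp (Complex.I * τ * Real.pi) = Complex.exp (Complex.I * Real.pi * τ) := by
      congr 1
      ring
    simp only [sub_zero, sub_self, p0, p1, ez, Complex.ofReal_zero, mul_zero, Complex.exp_zero,
      mul_one, add_zero]
    constructor
    · linear_combination solB₀ κ z g 0 * hd.eig_fst + solB₁ z g 0 * hd.assoc_fst
    · linear_combination solB₀ κ z g 0 * hd.eig_snd + solB₁ z g 0 * hd.assoc_snd
  · rw [basisOpAux_fst, basisOpAux_fst, map_sub, map_smul, map_smul]
    have e : Complex.I * (Complex.I * (z + τ)) = -(z + τ) := by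
      rw [← mul_assoc, Complex.I_mul_I]
      ring
    simp only [smul_neg, smul_sub, smul_smul, e, Complex.I_mul_I]
    change (z + τ) • reflect (rowFun κ τ (α 0) (β 0 - κ * Real.pi * α 0) (toL2 (solB₀ κ z g))
      (toL2 (solB₁ z g))) - _ = _
    module
  · rw [basisOpAux_snd, basisOpAux_snd]
    have e : Complex.I * (Complex.I * (z + τ)) = -(z + τ) := by
      rw [← mul_assoc, Complex.I_mul_I]
      ring
    simp only [smul_sub, smul_smul, e, Complex.I_mul_I]
    change (z + τ) • rowFun κ τ (α 1) (β 1) (toL2 (solB₀ κ z g)) (toL2 (solB₁ z g)) + _ = _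
    module

/-- No `z + τ` outside `τ + 2ℤ` is an eigenvalue of the free operator. -/
lemma eq_zero_of_free {M : Matrix (Fin 2) (Fin 4) ℂ} (hreg : IsRegular M) {κ τ : ℂ}
    {α β : Fin 2 → ℂ} (hd : RootData M κ τ α β) {z : ℂ} (hz : ∀ n : ℤ, z - 2 * n ≠ 0)
    {u₁ u₂ : ℝ → ℂ} {y₁ y₂ f₁ f₂ : L2} (h1 : IsH1 u₁ y₁ f₁) (h2 : IsH1 u₂ y₂ f₂)
    (hbc : SatisfiesBC M u₁ u₂) (k1 : (z + τ) • y₁ - Complex.I • f₁ = 0)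
    (k2 : (z + τ) • y₂ + Complex.I • f₂ = 0) : y₁ = 0 ∧ y₂ = 0 := by
  have s1 : f₁ = (-(Complex.I * (z + τ))) • y₁ := by
    have := congrArg (fun w => Complex.I • w) k1
    simp only [smul_sub, smul_smul, Complex.I_mul_I, smul_zero] at this
    rw [neg_one_smul, sub_neg_eq_add] at this
    rw [neg_smul]
    exact (neg_eq_of_add_eq_zero_right this).symm
  have s2 : f₂ = (Complex.I * (z + τ)) • y₂ := by
    have := congrArg (fun w => Complex.I • w) k2
    simp only [smul_add, smul_smul, Complex.I_mul_I, smul_zero] at this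
    rw [neg_one_smul, add_neg_eq_zero] at this
    exact this.symm
  have ae1 : ∀ᵐ x ∂muI, f₁ x = (-(Complex.I * (z + τ))) * y₁ x := by
    rw [s1]
    exact Lp.coeFn_smul _ _
  have ae2 : ∀ᵐ x ∂muI, f₂ x = (Complex.I * (z + τ)) * y₂ x := by
    rw [s2]
    exact Lp.coeFn_smul _ _
  have v1 := h1.eq_exp ae1
  have v2 := h2.eq_exp ae2
  obtain ⟨b1, b2⟩ := (satisfiesBC_iff hreg u₁ u₂).1 hbc
  rw [v1 _ pi_mem_Icc] at b1 b2
  rw [v2 _ pi_mem_Icc] at b2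
  set w := Complex.exp (Complex.I * (z + τ) * Real.pi) with hw
  set ζ := Complex.exp (Complex.I * Real.pi * τ) with hζ
  have hw0 : w ≠ 0 := Complex.exp_ne_zero _
  have hinv : Complex.exp (-(Complex.I * (z + τ)) * Real.pi) = w⁻¹ := by
    rw [hw, ← Complex.exp_neg]
    congr 1
    ring
  rw [hinv] at b1 b2
  have hne : w - ζ ≠ 0 := by
    intro h
    rw [sub_eq_zero, hw, hζ, Complex.exp_eq_exp_iff_exists_int] at h
    obtain ⟨n, hn⟩ := h
    apply hz n
    have hI : Complex.I * Real.pi ≠ 0 :=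
      mul_ne_zero Complex.I_ne_zero (Complex.ofReal_ne_zero.2 Real.pi_ne_zero)
    apply mul_left_cancel₀ hI
    linear_combination hn
  -- with `s = u₁(π)` the conditions read `(B + w) (s, u₂(0)) = 0`, and `det (B + w) = (w - ζ)²`
  set s := u₁ 0 * w⁻¹ with hs
  have hs' : u₁ 0 = s * w := by
    rw [hs]
    field_simp
  rw [hs'] at b1
  have hdet : (w + bcb M) * (w + bcc M) - bca M * bcd M = (w - ζ) ^ 2 := by
    linear_combination hd.det + w * hd.trace
  have z1 : s = 0 := by
    apply (mul_eq_zero.1 (?_ : (w - ζ) ^ 2 * s = 0)).resolve_left (pow_ne_zero 2 hne)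
    rw [← hdet]
    linear_combination (w + bcc M) * b1 - bca M * b2
  have z2 : u₂ 0 = 0 := by
    apply (mul_eq_zero.1 (?_ : (w - ζ) ^ 2 * u₂ 0 = 0)).resolve_left (pow_ne_zero 2 hne)
    rw [← hdet]
    linear_combination (w + bcb M) * b2 - bcd M * b1
  constructor
  · apply Lp.ext
    filter_upwards [h1.1, ae_mem_Icc, Lp.coeFn_zero ℂ 2 muI] with x e1 e2 e3
    rw [e1, v1 x e2, hs', z1, e3]
    simp
  · apply Lp.ext
    filter_upwards [h2.1, ae_mem_Icc, Lp.coeFn_zero ℂ 2 muI] with x e1 e2 e3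
    rw [e1, v2 x e2, z2, e3]
    simp

/-! ### The perturbation in the basis of root functions -/

/-- Multiplication of a fixed vector `ω ∈ H` by scalar bounded continuous functions. -/
def mulH (ω : H) : Cb →L[ℂ] H :=
  ((WithLp.prodContinuousLinearEquiv 2 ℂ L2 L2).symm : L2 × L2 →L[ℂ] H) ∘L
    (mulB.flip ω.fst).prod (mulB.flip ω.snd)

@[simp] lemma mulH_fst (ω : H) (h : Cb) : (mulH ω h).fst = mulB h ω.fst := rfl
@[simp] lemma mulH_snd (ω : H) (h : Cb) : (mulH ω h).snd = mulB h ω.snd := rfl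

lemma basisOpAux_mulH_fst (κ τ : ℂ) (α β : Fin 2 → ℂ) (y : H) (h : Cb) :
    (basisOpAux κ τ α β (mulH y h)).fst = mulB (reflB h) (basisOpAux κ τ α β y).fst := by
  rw [basisOpAux_fst, basisOpAux_fst, mulH_fst, mulH_snd, rowFun_mulB, reflect_mulB]

lemma basisOpAux_mulH_snd (κ τ : ℂ) (α β : Fin 2 → ℂ) (y : H) (h : Cb) :
    (basisOpAux κ τ α β (mulH y h)).snd = mulB h (basisOpAux κ τ α β y).snd := by
  rw [basisOpAux_snd, basisOpAux_snd, mulH_fst, mulH_snd, rowFun_mulB]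

/-- `w = v y`, where `v = [[0, P], [Q, 0]]`. -/
def IsPot (P Q : ℝ → ℂ) (y w : H) : Prop :=
  (∀ᵐ x ∂muI, w.fst x = P x * y.snd x) ∧ (∀ᵐ x ∂muI, w.snd x = Q x * y.fst x)

lemma IsPot.add {P Q : ℝ → ℂ} {y w y' w' : H} (h : IsPot P Q y w) (h' : IsPot P Q y' w') :
    IsPot P Q (y + y') (w + w') := by
  constructor
  · filter_upwards [h.1, h'.1, Lp.coeFn_add w.fst w'.fst, Lp.coeFn_add y.snd y'.snd]
      with x h1 h2 h3 h4
    rw [WithLp.add_fst, WithLp.add_snd, h3, h4, Pi.add_apply, Pi.add_apply, h1, h2]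
    ring
  · filter_upwards [h.2, h'.2, Lp.coeFn_add w.snd w'.snd, Lp.coeFn_add y.fst y'.fst]
      with x h1 h2 h3 h4
    rw [WithLp.add_fst, WithLp.add_snd, h3, h4, Pi.add_apply, Pi.add_apply, h1, h2]
    ring

lemma IsPot.unique {P Q : ℝ → ℂ} {y w w' : H} (h : IsPot P Q y w) (h' : IsPot P Q y w') :
    w = w' := by
  apply H_ext <;> apply Lp.ext
  · filter_upwards [h.1, h'.1] with x h1 h2
    rw [h1, h2]
  · filter_upwards [h.2, h'.2] with x h1 h2
    rw [h1, h2]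

lemma exists_isPot {P Q : ℝ → ℂ} (hP : MemLp P 2 muI) (hQ : MemLp Q 2 muI) {y : H} {w₁ w₂ : Cb}
    (h₁ : y.fst =ᵐ[muI] w₁) (h₂ : y.snd =ᵐ[muI] w₂) : ∃ w : H, IsPot P Q y w := by
  refine ⟨WithLp.toLp 2 (mulB w₂ (hP.toLp P), mulB w₁ (hQ.toLp Q)), ?_, ?_⟩
  · filter_upwards [coeFn_mulB w₂ (hP.toLp P), hP.coeFn_toLp, h₂] with x e1 e2 e3
    rw [WithLp.toLp_fst, e1, e2, e3, mul_comm]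
  · filter_upwards [coeFn_mulB w₁ (hQ.toLp Q), hQ.coeFn_toLp, h₁] with x e1 e2 e3
    rw [WithLp.toLp_snd, e1, e2, e3, mul_comm]

/-- `A` intertwines multiplication by a scalar function `h` with multiplication by
`(h(π - x), h(x))`, and `v` exchanges the two components. So `A⁻¹ v A` acts as reflection of the
scalar factor followed by multiplication. -/
lemma IsPot.mulH {P Q : ℝ → ℂ} {κ τ : ℂ} {α β : Fin 2 → ℂ} {e ω : H}
    (h : IsPot P Q (basisOpAux κ τ α β e) (basisOpAux κ τ α β ω)) (p : Cb) :
    IsPot P Q (basisOpAux κ τ α β (mulH e p)) (basisOpAux κ τ α β (Dirac.mulH ω (reflB p))) := by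
  unfold IsPot
  rw [basisOpAux_mulH_fst, basisOpAux_mulH_snd, basisOpAux_mulH_fst, basisOpAux_mulH_snd,
    reflB_reflB]
  constructor
  · filter_upwards [h.1, coeFn_mulB p (basisOpAux κ τ α β ω).fst,
      coeFn_mulB p (basisOpAux κ τ α β e).snd] with x h1 h2 h3
    rw [h2, h3, h1]
    ring
  · filter_upwards [h.2, coeFn_mulB (reflB p) (basisOpAux κ τ α β ω).snd,
      coeFn_mulB (reflB p) (basisOpAux κ τ α β e).fst] with x h1 h2 h3
    rw [h2, h3, h1]
    ring

/-- The operator `A⁻¹ v A D`, where `D` is the conjugated free resolvent and the vectors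
`ω ν = A⁻¹ v A e₀^ν` are the columns of the matrix function `A⁻¹ v A`. -/
def perturbOp (κ z : ℂ) (ω : Fin 2 → H) : H →L[ℂ] H :=
  mulH (ω 0) ∘L reflB ∘L solB₀ κ z + mulH (ω 1) ∘L reflB ∘L solB₁ z

lemma mulB_expFun_zero (h : Cb) : mulB h (expFun 0) = toL2 h := by
  apply Lp.ext
  filter_upwards [coeFn_mulB h (expFun 0), coeFn_expFun 0, coeFn_toL2 h] with x h1 h2 h3
  rw [h1, h2, h3]
  simp

lemma freeSol_eq (κ z : ℂ) (g : H) :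
    freeSol κ z g = mulH (stdBasis 0 0) (solB₀ κ z g) + mulH (stdBasis 1 0) (solB₁ z g) := by
  rw [freeSol_apply]
  apply H_ext
  · simp [stdBasis, mulB_expFun_zero]
  · simp [stdBasis, mulB_expFun_zero]

lemma isPot_freeSol {P Q : ℝ → ℂ} {κ τ : ℂ} {α β : Fin 2 → ℂ} {ω : Fin 2 → H}
    (h : ∀ ν, IsPot P Q (basisOpAux κ τ α β (stdBasis ν 0)) (basisOpAux κ τ α β (ω ν)))
    (z : ℂ) (g : H) :
    IsPot P Q (basisOpAux κ τ α β (freeSol κ z g)) (basisOpAux κ τ α β (perturbOp κ z ω g)) := by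
  have h1 := ((h 0).mulH (solB₀ κ z g)).add ((h 1).mulH (solB₁ z g))
  rw [← map_add, ← map_add, ← freeSol_eq] at h1
  exact h1

/-! ### The graph of the perturbed operator -/

lemma mem_graph_free {M : Matrix (Fin 2) (Fin 4) ℂ} (hreg : IsRegular M) {κ τ : ℂ}
    {α β : Fin 2 → ℂ} (hd : RootData M κ τ α β) {z : ℂ} (hz : ∀ n : ℤ, z - 2 * n ≠ 0) (g : H) :
    (basisOpAux κ τ α β (freeSol κ z g), (z + τ) • basisOpAux κ τ α β (freeSol κ z g) -
      basisOpAux κ τ α β g) ∈ graph M (fun _ => 0) (fun _ => 0) := by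
  obtain ⟨u₁, u₂, f₁, f₂, h1, h2, h3, h4, h5⟩ := exists_isH1_free hreg hd hz g
  refine ⟨u₁, u₂, f₁, f₂, h1, h2, h3, ?_, ?_⟩
  · have e : ((z + τ) • basisOpAux κ τ α β (freeSol κ z g) - basisOpAux κ τ α β g).fst =
        Complex.I • f₁ := by
      rw [WithLp.sub_fst, WithLp.smul_fst, ← h4]
      module
    filter_upwards [Lp.coeFn_smul Complex.I f₁] with x hx
    rw [e, hx]
    simp
  · have e : ((z + τ) • basisOpAux κ τ α β (freeSol κ z g) - basisOpAux κ τ α β g).snd =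
        (-Complex.I) • f₂ := by
      rw [WithLp.sub_snd, WithLp.smul_snd, ← h5]
      module
    filter_upwards [Lp.coeFn_smul (-Complex.I) f₂] with x hx
    rw [e, hx]
    simp

lemma eq_zero_of_mem_graph_free {M : Matrix (Fin 2) (Fin 4) ℂ} (hreg : IsRegular M) {κ τ : ℂ}
    {α β : Fin 2 → ℂ} (hd : RootData M κ τ α β) {z : ℂ} (hz : ∀ n : ℤ, z - 2 * n ≠ 0) {y : H}
    (h : (y, (z + τ) • y) ∈ graph M (fun _ => 0) (fun _ => 0)) : y = 0 := by
  obtain ⟨u₁, u₂, f₁, f₂, h1, h2, h3, h4, h5⟩ := h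
  have e1 : (z + τ) • y.fst = Complex.I • f₁ := by
    apply Lp.ext
    filter_upwards [h4, Lp.coeFn_smul Complex.I f₁] with x k1 k2
    rw [k2]
    simpa using k1
  have e2 : (z + τ) • y.snd = (-Complex.I) • f₂ := by
    apply Lp.ext
    filter_upwards [h5, Lp.coeFn_smul (-Complex.I) f₂] with x k1 k2
    rw [k2]
    simpa using k1
  obtain ⟨z1, z2⟩ := eq_zero_of_free hreg hd hz h1 h2 h3 (by rw [e1, sub_self])
    (by rw [e2]; module)
  exact H_ext z1 z2

/-- Adding the potential `ζ v` leaves the domain unchanged. -/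
lemma mem_graph_perturb {M : Matrix (Fin 2) (Fin 4) ℂ} {P Q : ℝ → ℂ} (ζ : ℂ) {y w f : H}
    (hw : IsPot P Q y w) : (y, f) ∈ graph M (fun _ => 0) (fun _ => 0) ↔
      (y, f + ζ • w) ∈ graph M (fun x => ζ * P x) (fun x => ζ * Q x) := by
  have c1 := Lp.coeFn_add f.fst (ζ • w).fst
  have c2 := Lp.coeFn_add f.snd (ζ • w).snd
  have s1 := Lp.coeFn_smul ζ w.fst
  have s2 := Lp.coeFn_smul ζ w.snd
  constructor
  · rintro ⟨u₁, u₂, f₁, f₂, h1, h2, h3, h4, h5⟩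
    refine ⟨u₁, u₂, f₁, f₂, h1, h2, h3, ?_, ?_⟩
    · filter_upwards [c1, s1, h4, hw.1, h2.1] with x k1 k2 k3 k4 k5
      simp only [WithLp.add_fst, k1, Pi.add_apply]
      rw [k3, WithLp.smul_fst, k2, Pi.smul_apply, k4, k5, smul_eq_mul]
      ring
    · filter_upwards [c2, s2, h5, hw.2, h1.1] with x k1 k2 k3 k4 k5
      simp only [WithLp.add_snd, k1, Pi.add_apply]
      rw [k3, WithLp.smul_snd, k2, Pi.smul_apply, k4, k5, smul_eq_mul]
      ring
  · rintro ⟨u₁, u₂, f₁, f₂, h1, h2, h3, h4, h5⟩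
    refine ⟨u₁, u₂, f₁, f₂, h1, h2, h3, ?_, ?_⟩
    · filter_upwards [c1, s1, h4, hw.1, h2.1] with x k1 k2 k3 k4 k5
      simp only [WithLp.add_fst, k1, Pi.add_apply] at k3
      rw [WithLp.smul_fst, k2, Pi.smul_apply, k4, k5, smul_eq_mul] at k3
      linear_combination k3
    · filter_upwards [c2, s2, h5, hw.2, h1.1] with x k1 k2 k3 k4 k5
      simp only [WithLp.add_snd, k1, Pi.add_apply] at k3
      rw [WithLp.smul_snd, k2, Pi.smul_apply, k4, k5, smul_eq_mul] at k3
      linear_combination k3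

/-- `v y ∈ L²` for `y` in the domain, since `y` is bounded. -/
lemma exists_isPot_of_mem_graph {M : Matrix (Fin 2) (Fin 4) ℂ} {P Q P' Q' : ℝ → ℂ}
    (hP : MemLp P 2 muI) (hQ : MemLp Q 2 muI) {y f : H} (h : (y, f) ∈ graph M P' Q') :
    ∃ w : H, IsPot P Q y w := by
  obtain ⟨u₁, u₂, f₁, f₂, h1, h2, -⟩ := h
  obtain ⟨w₁, hw₁⟩ := h1.exists_bounded
  obtain ⟨w₂, hw₂⟩ := h2.exists_bounded
  refine exists_isPot hP hQ (w₁ := w₁) (w₂ := w₂) ?_ ?_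
  · filter_upwards [h1.1, ae_mem_Icc] with x k1 k2
    rw [k1, hw₁ x k2]
  · filter_upwards [h2.1, ae_mem_Icc] with x k1 k2
    rw [k1, hw₂ x k2]

/-- If `1 - ζ A⁻¹ v A D` is invertible, then `z + τ` belongs to the resolvent set: the resolvent is
`A D (1 - ζ A⁻¹ v A D)⁻¹ A⁻¹`. -/
theorem mem_resolventSet_of_isUnit {M : Matrix (Fin 2) (Fin 4) ℂ} (hreg : IsRegular M) {κ τ : ℂ}
    {α β : Fin 2 → ℂ} (hd : RootData M κ τ α β) {P Q : ℝ → ℂ} (hP : MemLp P 2 muI)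
    (hQ : MemLp Q 2 muI) {ω : Fin 2 → H}
    (hω : ∀ ν, IsPot P Q (basisOpAux κ τ α β (stdBasis ν 0)) (basisOpAux κ τ α β (ω ν)))
    {z ζ : ℂ} (hz : ∀ n : ℤ, z - 2 * n ≠ 0) (hu : IsUnit (1 - ζ • perturbOp κ z ω)) :
    z + τ ∈ resolventSet (op M (fun x => ζ * P x) (fun x => ζ * Q x)) := by
  set A := basisOpAux κ τ α β with hA
  have hAinv : A.IsInvertible := isInvertible_basisOpAux hd.indep
  set G := perturbOp κ z ω with hG
  obtain ⟨U, hU⟩ := hu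
  set S : H →L[ℂ] H := ((U⁻¹ : (H →L[ℂ] H)ˣ) : H →L[ℂ] H) with hS
  have hGS : ∀ f, S f - ζ • G (S f) = f := by
    intro f
    have : (1 - ζ • G) * S = 1 := by
      rw [hS, ← hU]
      exact U.mul_inv
    simpa using congrArg (fun B : H →L[ℂ] H => B f) this
  have hSG : ∀ f, f - ζ • G f = 0 → f = 0 := by
    intro f hf
    have : S * (1 - ζ • G) = 1 := by
      rw [hS, ← hU]
      exact U.inv_mul
    have h2 := congrArg (fun B : H →L[ℂ] H => B f) this
    simp only [mul_apply_eq_comp, sub_apply, one_apply_eq_self,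
      smul_apply] at h2
    rw [← h2, hf, map_zero]
  have hmem : ∀ g : H, (A (freeSol κ z g), (z + τ) • A (freeSol κ z g) - A g + ζ • A (G g)) ∈
      graph M (fun x => ζ * P x) (fun x => ζ * Q x) := fun g =>
    (mem_graph_perturb ζ (isPot_freeSol hω z g)).1 (mem_graph_free hreg hd hz g)
  have hres : ∀ f : H, (A (freeSol κ z (S (A.inverse f))),
      (z + τ) • A (freeSol κ z (S (A.inverse f))) - f) ∈
      graph M (fun x => ζ * P x) (fun x => ζ * Q x) := by
    intro f
    have e : (z + τ) • A (freeSol κ z (S (A.inverse f))) - A (S (A.inverse f)) +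
        ζ • A (G (S (A.inverse f))) = (z + τ) • A (freeSol κ z (S (A.inverse f))) - f := by
      have := congrArg A (hGS (A.inverse f))
      rw [map_sub, map_smul, hAinv.self_apply_inverse] at this
      linear_combination (norm := module) (-1 : ℂ) • this
    rw [← e]
    exact hmem _
  have hinj : ∀ d : H, (d, (z + τ) • d) ∈ graph M (fun x => ζ * P x) (fun x => ζ * Q x) →
      d = 0 := by
    intro d hdg
    obtain ⟨w, hw⟩ := exists_isPot_of_mem_graph hP hQ hdg
    have h0 : (d, (z + τ) • d - ζ • w) ∈ graph M (fun _ => 0) (fun _ => 0) := by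
      rw [mem_graph_perturb ζ hw, sub_add_cancel]
      exact hdg
    set g := A.inverse (ζ • w) with hg
    have hAg : A g = ζ • w := hAinv.self_apply_inverse _
    have h1 := mem_graph_free hreg hd hz g
    rw [← hA, hAg] at h1
    have h2 : (d - A (freeSol κ z g), (z + τ) • (d - A (freeSol κ z g))) ∈
        graph M (fun _ => 0) (fun _ => 0) := by
      have := Submodule.sub_mem _ h0 h1
      rw [Prod.mk_sub_mk] at this
      convert this using 2
      module
    have h3 := sub_eq_zero.1 (eq_zero_of_mem_graph_free hreg hd hz h2)
    have h4 : A (G g) = w := by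
      apply IsPot.unique (isPot_freeSol hω z g)
      rw [← hA, ← h3]
      exact hw
    have h5 : g = 0 := by
      apply hSG
      apply hAinv.injective
      rw [map_sub, map_smul, h4, hAg, sub_self, map_zero]
    rw [h3, h5, map_zero, map_zero]
  have hleft : ∀ y w : H, (y, w) ∈ graph M (fun x => ζ * P x) (fun x => ζ * Q x) →
      A (freeSol κ z (S (A.inverse ((z + τ) • y - w)))) = y := by
    intro y w h2
    have h3 := Submodule.sub_mem _ (hres ((z + τ) • y - w)) h2
    rw [Prod.mk_sub_mk] at h3
    generalize A (freeSol κ z (S (A.inverse ((z + τ) • y - w)))) = x at h3 ⊢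
    apply sub_eq_zero.1
    apply hinj
    convert h3 using 2
    module
  refine ⟨A ∘L freeSol κ z ∘L S ∘L A.inverse, fun f => ?_, fun y => ?_⟩
  · have h1 := hres f
    rw [← op_graph] at h1
    obtain ⟨x, hx1, hx2⟩ := (LinearPMap.mem_graph_iff _).1 h1
    refine ⟨LinearPMap.mem_domain_of_mem_graph h1, ?_⟩
    have hx : x = ⟨_, LinearPMap.mem_domain_of_mem_graph h1⟩ := Subtype.ext hx1
    rw [hx] at hx2
    change (z + τ) • A (freeSol κ z (S (A.inverse f))) - _ = f
    refine (congrArg (fun t => (z + τ) • A (freeSol κ z (S (A.inverse f))) - t) hx2).trans ?_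
    exact sub_sub_cancel _ _
  · have h2 := (op M (fun x => ζ * P x) (fun x => ζ * Q x)).mem_graph y
    rw [op_graph] at h2
    have h3 := hleft (y : H) _ h2
    simp only [ContinuousLinearMap.comp_apply]
    exact h3

/-! ### The matrix elements as Fourier coefficients -/

lemma exists_bounded_of_continuous {h : ℝ → ℂ} (hh : Continuous h) :
    ∃ w : Cb, ∀ x ∈ Icc 0 Real.pi, w x = h x := by
  refine ⟨(BoundedContinuousFunction.mkOfCompact ⟨fun x : Icc 0 Real.pi => h x,
    hh.comp continuous_subtype_val⟩).compContinuous
    ⟨projIcc 0 Real.pi Real.pi_pos.le, continuous_projIcc⟩, fun x hx => ?_⟩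
  simp [projIcc_of_mem Real.pi_pos.le hx]

lemma exists_bounded_rowFun (κ τ a b : ℂ) {f g : L2} {p q : Cb} (hf : f =ᵐ[muI] p)
    (hg : g =ᵐ[muI] q) : ∃ w : Cb, rowFun κ τ a b f g =ᵐ[muI] w := by
  have hp := p.continuous
  have hq := q.continuous
  obtain ⟨w, hw⟩ := exists_bounded_of_continuous (h := fun x : ℝ =>
    (a * p x + (b + κ * a * x) * q x) * Complex.exp (Complex.I * τ * x)) (by fun_prop)
  refine ⟨w, ?_⟩
  filter_upwards [coeFn_rowFun κ τ a b f g, hf, hg, ae_mem_Icc] with x h1 h2 h3 h4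
  rw [h1, h2, h3, hw x h4]

lemma exists_isPot_basisOpAux {P Q : ℝ → ℂ} (hP : MemLp P 2 muI) (hQ : MemLp Q 2 muI) (κ τ : ℂ)
    (α β : Fin 2 → ℂ) {e : H} {p q : Cb} (h1 : e.fst =ᵐ[muI] p) (h2 : e.snd =ᵐ[muI] q) :
    ∃ w : H, IsPot P Q (basisOpAux κ τ α β e) w := by
  obtain ⟨w₁, hw₁⟩ := exists_bounded_rowFun κ τ (α 0) (β 0 - κ * Real.pi * α 0) h1 h2
  obtain ⟨w₂, hw₂⟩ := exists_bounded_rowFun κ τ (α 1) (β 1) h1 h2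
  refine exists_isPot hP hQ (w₁ := reflB w₁) (w₂ := w₂) ?_ ?_
  · rw [basisOpAux_fst]
    filter_upwards [coeFn_reflect (rowFun κ τ (α 0) (β 0 - κ * Real.pi * α 0) e.fst e.snd),
      ae_reflect hw₁] with x k1 k2
    rw [k1, k2, reflB_apply]
  · rw [basisOpAux_snd]
    exact hw₂

/-- The columns `ω ν = A⁻¹ v A e₀^ν` of the matrix function `A⁻¹ v A`. -/
lemma exists_columns {κ τ : ℂ} {α β : Fin 2 → ℂ}
    (hA : (basisOpAux κ τ α β).IsInvertible) {P Q : ℝ → ℂ} (hP : MemLp P 2 muI)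
    (hQ : MemLp Q 2 muI) : ∃ ω : Fin 2 → H,
      ∀ ν, IsPot P Q (basisOpAux κ τ α β (stdBasis ν 0)) (basisOpAux κ τ α β (ω ν)) := by
  have h : ∀ ν : Fin 2, ∃ w : H, IsPot P Q (basisOpAux κ τ α β (stdBasis ν 0)) w := by
    intro ν
    have h0 : (0 : L2) =ᵐ[muI] (0 : Cb) := Lp.coeFn_zero ℂ 2 muI
    have h1 : expFun 0 =ᵐ[muI] expB 0 := by
      rw [← mul_zero 2, ← toL2_expB]
      exact coeFn_toL2 _
    fin_cases ν
    · exact exists_isPot_basisOpAux hP hQ κ τ α β (e := stdBasis 0 0) h1 h0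
    · exact exists_isPot_basisOpAux hP hQ κ τ α β (e := stdBasis 1 0) h0 h1
  choose w hw using h
  refine ⟨fun ν => (basisOpAux κ τ α β).inverse (w ν), fun ν => ?_⟩
  rw [hA.self_apply_inverse]
  exact hw ν

lemma integral_eq_inner (y w : H) :
    ∫ x, (w.fst x * starRingEnd ℂ (y.fst x) + w.snd x * starRingEnd ℂ (y.snd x)) ∂muI =
      inner ℂ y w := by
  rw [WithLp.prod_inner_apply, L2.inner_def, L2.inner_def,
    ← integral_add (L2.integrable_inner _ _) (L2.integrable_inner _ _)]
  rfl

/-- The matrix element `w^{μν}(m)` is a Fourier coefficient of `A⁻¹ v A`. -/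
lemma matElem_eq {κ τ : ℂ} {α β : Fin 2 → ℂ} (hA : (basisOpAux κ τ α β).IsInvertible)
    {P Q : ℝ → ℂ} {ω : Fin 2 → H}
    (hω : ∀ ν, IsPot P Q (basisOpAux κ τ α β (stdBasis ν 0)) (basisOpAux κ τ α β (ω ν)))
    (μ ν : Fin 2) (m : ℤ) :
    matElem (basisOpAux κ τ α β) P Q μ ν m 0 = inner ℂ (stdBasis μ m) (ω ν) := by
  have h1 : matElem (basisOpAux κ τ α β) P Q μ ν m 0 =
      inner ℂ (biorthFun (basisOpAux κ τ α β) μ m) (basisOpAux κ τ α β (ω ν)) := by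
    rw [← integral_eq_inner, matElem]
    apply integral_congr_ae
    filter_upwards [(hω ν).1, (hω ν).2] with x k1 k2
    rw [k1, k2]
    rfl
  rw [h1, biorthFun, ContinuousLinearMap.adjoint_inner_left, hA.inverse_apply_self]

lemma inner_stdBasis_zero (m : ℤ) (y : H) :
    inner ℂ (stdBasis 0 m) y = inner ℂ (expFun m) y.fst := by
  simp [stdBasis, WithLp.prod_inner_apply]

lemma inner_stdBasis_one (m : ℤ) (y : H) :
    inner ℂ (stdBasis 1 m) y = inner ℂ (expFun m) y.snd := by
  simp [stdBasis, WithLp.prod_inner_apply]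

lemma rNormSq_nonneg (A : H →L[ℂ] H) (P Q : ℝ → ℂ) : 0 ≤ rNormSq A P Q :=
  tsum_nonneg fun _ => sq_nonneg _

/-- By Parseval's identity, `‖r‖` bounds the `L²` norms of the entries of `A⁻¹ v A`. -/
lemma norm_columns_sq_le {κ τ : ℂ} {α β : Fin 2 → ℂ} (hA : (basisOpAux κ τ α β).IsInvertible)
    {P Q : ℝ → ℂ} {ω : Fin 2 → H}
    (hω : ∀ ν, IsPot P Q (basisOpAux κ τ α β (stdBasis ν 0)) (basisOpAux κ τ α β (ω ν)))
    (ν : Fin 2) :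
    ‖(ω ν).fst‖ ^ 2 ≤ rNormSq (basisOpAux κ τ α β) P Q ∧
      ‖(ω ν).snd‖ ^ 2 ≤ rNormSq (basisOpAux κ τ α β) P Q := by
  set A := basisOpAux κ τ α β
  have hs : ∀ μ ν : Fin 2, Summable fun n : ℤ => ‖matElem A P Q μ ν (2 * n) 0‖ ^ 2 := by
    intro μ ν
    simp only [A, matElem_eq hA hω]
    fin_cases μ
    · simp only [Fin.zero_eta, inner_stdBasis_zero]
      exact (hasSum_norm_inner_sq _).summable
    · simp only [Fin.mk_one, inner_stdBasis_one]
      exact (hasSum_norm_inner_sq _).summable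
  have hle : ∀ (p : Fin 2 × Fin 2) (m : ℤ), ‖matElem A P Q p.1 p.2 m 0‖ ≤ rSeq A P Q m :=
    fun p m => le_ciSup (f := fun p : Fin 2 × Fin 2 => ‖matElem A P Q p.1 p.2 m 0‖)
      (Set.finite_range _).bddAbove p
  have hr : ∀ n : ℤ, rSeq A P Q (2 * n) ^ 2 ≤
      ∑ p : Fin 2 × Fin 2, ‖matElem A P Q p.1 p.2 (2 * n) 0‖ ^ 2 := by
    intro n
    obtain ⟨p, hp⟩ := exists_eq_ciSup_of_finite
      (f := fun p : Fin 2 × Fin 2 => ‖matElem A P Q p.1 p.2 (2 * n) 0‖)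
    rw [rSeq, ← hp]
    exact Finset.single_le_sum (f := fun p : Fin 2 × Fin 2 =>
      ‖matElem A P Q p.1 p.2 (2 * n) 0‖ ^ 2) (fun _ _ => sq_nonneg _) (Finset.mem_univ p)
  have hrs : Summable fun n : ℤ => rSeq A P Q (2 * n) ^ 2 :=
    (summable_sum fun p _ => hs p.1 p.2).of_nonneg_of_le (fun _ => sq_nonneg _) hr
  have key : ∀ μ : Fin 2, ∑' n : ℤ, ‖matElem A P Q μ ν (2 * n) 0‖ ^ 2 ≤ rNormSq A P Q := by
    intro μ
    refine (hs μ ν).tsum_le_tsum (fun n => ?_) hrs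
    exact pow_le_pow_left₀ (norm_nonneg _) (hle (μ, ν) _) 2
  constructor
  · refine le_of_eq_of_le ?_ (key 0)
    simp only [A, matElem_eq hA hω, inner_stdBasis_zero]
    exact (hasSum_norm_inner_sq _).tsum_eq.symm
  · refine le_of_eq_of_le ?_ (key 1)
    simp only [A, matElem_eq hA hω, inner_stdBasis_one]
    exact (hasSum_norm_inner_sq _).tsum_eq.symm

/-! ### Norm estimates -/

lemma inner_mult (z : ℂ) (n : ℤ) (f : L2) :
    inner ℂ (expFun (2 * n)) (mult z f) = (z - 2 * n)⁻¹ * inner ℂ (expFun (2 * n)) f := by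
  have key : innerSL ℂ (expFun (2 * n)) ∘L mult z =
      (z - 2 * (n : ℂ))⁻¹ • innerSL ℂ (expFun (2 * n)) := by
    apply clm_ext_expFun
    intro k
    have h := orthonormal_iff_ite.1 orthonormal_expFun n k
    simp only [ContinuousLinearMap.comp_apply, smul_apply, innerSL_apply_apply, mult_expFun,
      inner_smul_right]
    rw [h]
    split_ifs with hnk
    · rw [hnk]
      simp
    · simp
  exact congrArg (fun L : L2 →L[ℂ] ℂ => L f) key

lemma norm_mult_le {z : ℂ} {h : ℝ} (hh : 0 < h) (hz : ∀ n : ℤ, h ≤ ‖z - 2 * n‖) (f : L2) :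
    ‖mult z f‖ ≤ h⁻¹ * ‖f‖ := by
  have h1 := hasSum_norm_inner_sq (mult z f)
  have h2 := (hasSum_norm_inner_sq f).mul_left (h⁻¹ ^ 2)
  have h3 : ‖mult z f‖ ^ 2 ≤ (h⁻¹ * ‖f‖) ^ 2 := by
    rw [mul_pow]
    refine hasSum_le (fun n => ?_) h1 h2
    rw [inner_mult, norm_mul, mul_pow, norm_inv]
    have : ‖z - 2 * (n : ℂ)‖⁻¹ ≤ h⁻¹ := inv_anti₀ hh (hz n)
    gcongr
  exact (sq_le_sq₀ (norm_nonneg _) (by positivity)).1 h3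

lemma norm_fst_le (g : H) : ‖g.fst‖ ≤ ‖g‖ := WithLp.norm_fst_le _ _

lemma norm_snd_le (g : H) : ‖g.snd‖ ≤ ‖g‖ := WithLp.norm_snd_le _ _

lemma norm_sq_H (g : H) : ‖g‖ ^ 2 = ‖g.fst‖ ^ 2 + ‖g.snd‖ ^ 2 :=
  WithLp.prod_norm_sq_eq_of_L2 g

lemma perturbOp_fst (κ z : ℂ) (ω : Fin 2 → H) (g : H) : (perturbOp κ z ω g).fst =
    mulB (reflB (solB₀ κ z g)) (ω 0).fst + mulB (reflB (solB₁ z g)) (ω 1).fst := rfl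

lemma perturbOp_snd (κ z : ℂ) (ω : Fin 2 → H) (g : H) : (perturbOp κ z ω g).snd =
    mulB (reflB (solB₀ κ z g)) (ω 0).snd + mulB (reflB (solB₁ z g)) (ω 1).snd := rfl

lemma norm_mulB_reflB_add_le {p q : Cb} {f g : L2} {ρ : ℝ} (hf : ‖f‖ ≤ ρ) (hg : ‖g‖ ≤ ρ) :
    ‖mulB (reflB p) f + mulB (reflB q) g‖ ≤ ρ * (‖p‖ + ‖q‖) := by
  refine (norm_add_le _ _).trans ?_
  have h1 := (norm_mulB_le (reflB p) f).trans
    (mul_le_mul (norm_reflB_le p) hf (norm_nonneg _) (norm_nonneg _))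
  have h2 := (norm_mulB_le (reflB q) g).trans
    (mul_le_mul (norm_reflB_le q) hg (norm_nonneg _) (norm_nonneg _))
  linarith

lemma norm_perturbOp_sq_le {κ z : ℂ} {ω : Fin 2 → H} {ρ : ℝ}
    (hω : ∀ ν, ‖(ω ν).fst‖ ≤ ρ ∧ ‖(ω ν).snd‖ ≤ ρ) (g : H) :
    ‖perturbOp κ z ω g‖ ^ 2 ≤ 2 * ρ ^ 2 * (‖solB₀ κ z g‖ + ‖solB₁ z g‖) ^ 2 := by
  have h1 : ‖(perturbOp κ z ω g).fst‖ ^ 2 ≤ (ρ * (‖solB₀ κ z g‖ + ‖solB₁ z g‖)) ^ 2 := by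
    rw [perturbOp_fst]
    exact pow_le_pow_left₀ (norm_nonneg _) (norm_mulB_reflB_add_le (hω 0).1 (hω 1).1) 2
  have h2 : ‖(perturbOp κ z ω g).snd‖ ^ 2 ≤ (ρ * (‖solB₀ κ z g‖ + ‖solB₁ z g‖)) ^ 2 := by
    rw [perturbOp_snd]
    exact pow_le_pow_left₀ (norm_nonneg _) (norm_mulB_reflB_add_le (hω 0).2 (hω 1).2) 2
  rw [norm_sq_H]
  linarith

lemma solB₀_eq (κ z : ℂ) (g : H) :
    solB₀ κ z g = multB z (g.fst - (Complex.I * κ) • mult z g.snd) := rfl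

lemma norm_sub_smul_mult_le {κ z : ℂ} (hκ : ‖κ‖ ≤ 1) {h : ℝ} (hh : 0 < h)
    (hz : ∀ n : ℤ, h ≤ ‖z - 2 * n‖) (f g : L2) :
    ‖f - (Complex.I * κ) • mult z g‖ ≤ ‖f‖ + h⁻¹ * ‖g‖ := by
  refine (norm_sub_le _ _).trans (add_le_add le_rfl ?_)
  rw [norm_smul, norm_mul, Complex.norm_I, one_mul]
  exact (mul_le_of_le_one_left (norm_nonneg _) hκ).trans (norm_mult_le hh hz g)

lemma norm_perturbOp_sq_le_of_half {κ z : ℂ} (hκ : ‖κ‖ ≤ 1) {ω : Fin 2 → H} {ρ : ℝ}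
    (hω : ∀ ν, ‖(ω ν).fst‖ ≤ ρ ∧ ‖(ω ν).snd‖ ≤ ρ) (hz : ∀ n : ℤ, 1 / 2 ≤ ‖z - 2 * n‖) (g : H) :
    ‖perturbOp κ z ω g‖ ^ 2 ≤ 20 * ρ ^ 2 * sig z ^ 2 * ‖g‖ ^ 2 := by
  have h0 : ‖solB₀ κ z g‖ ≤ sig z * (‖g.fst‖ + 2 * ‖g.snd‖) := by
    rw [solB₀_eq]
    refine (norm_multB_le _ _).trans (mul_le_mul_of_nonneg_left ?_ (sig_nonneg z))
    have := norm_sub_smul_mult_le hκ (by norm_num : (0 : ℝ) < 1 / 2) hz g.fst g.snd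
    norm_num at this
    exact this
  have h1 : ‖solB₁ z g‖ ≤ sig z * ‖g.snd‖ := norm_multB_le _ _
  have h2 : (‖solB₀ κ z g‖ + ‖solB₁ z g‖) ^ 2 ≤ (sig z * (‖g.fst‖ + 3 * ‖g.snd‖)) ^ 2 := by
    apply pow_le_pow_left₀ (by positivity)
    linarith
  -- Cauchy's inequality `(s + 3t)² ≤ 10 (s² + t²)`
  have h3 : (‖g.fst‖ + 3 * ‖g.snd‖) ^ 2 ≤ 10 * ‖g‖ ^ 2 := by
    rw [norm_sq_H]
    nlinarith [sq_nonneg (3 * ‖g.fst‖ - ‖g.snd‖)]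
  calc _ ≤ 2 * ρ ^ 2 * (‖solB₀ κ z g‖ + ‖solB₁ z g‖) ^ 2 := norm_perturbOp_sq_le hω g
    _ ≤ 2 * ρ ^ 2 * (sig z * (‖g.fst‖ + 3 * ‖g.snd‖)) ^ 2 := by gcongr
    _ = 2 * ρ ^ 2 * sig z ^ 2 * (‖g.fst‖ + 3 * ‖g.snd‖) ^ 2 := by ring
    _ ≤ 2 * ρ ^ 2 * sig z ^ 2 * (10 * ‖g‖ ^ 2) := by gcongr
    _ = _ := by ring

/-! ### Large imaginary parts -/

/-- The norm of `ζ A⁻¹ v A D` is less than one: its square is at most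
`20 ρ2 σ² ≤ 160 ρ2 / T ≤ 160 / 192`. -/
lemma isUnit_of_im {κ z ζ : ℂ} (hκ : ‖κ‖ ≤ 1) (hζ : ‖ζ‖ ≤ 1) {ω : Fin 2 → H} {ρ2 T : ℝ}
    (hω : ∀ ν, ‖(ω ν).fst‖ ^ 2 ≤ ρ2 ∧ ‖(ω ν).snd‖ ^ 2 ≤ ρ2) (hT1 : 1 ≤ T)
    (hT : 192 * ρ2 ≤ T) (hz : T / 2 ≤ |z.im|) : IsUnit (1 - ζ • perturbOp κ z ω) := by
  have hρ : 0 ≤ ρ2 := (sq_nonneg _).trans (hω 0).1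
  have hz2 : ∀ n : ℤ, 1 / 2 ≤ ‖z - 2 * n‖ := by
    intro n
    have h1 : |(z - 2 * (n : ℂ)).im| = |z.im| := by simp
    have h2 := Complex.abs_im_le_norm (z - 2 * (n : ℂ))
    linarith
  have hσ : sig z ^ 2 ≤ 8 / T := by
    rw [sig_sq]
    refine (tsum_inv_sq_le_of_im (by linarith) hz).trans_eq ?_
    field_simp
    norm_num
  have hb : ∀ g, ‖perturbOp κ z ω g‖ ≤ Real.sqrt (5 / 6) * ‖g‖ := by
    intro g
    have h1 := norm_perturbOp_sq_le_of_half hκ (ρ := Real.sqrt ρ2)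
      (fun ν => ⟨Real.le_sqrt_of_sq_le (hω ν).1, Real.le_sqrt_of_sq_le (hω ν).2⟩) hz2 g
    rw [Real.sq_sqrt hρ] at h1
    have h2 : 20 * ρ2 * sig z ^ 2 ≤ 5 / 6 := by
      calc 20 * ρ2 * sig z ^ 2 ≤ 20 * ρ2 * (8 / T) := by gcongr
        _ = 160 * ρ2 / T := by ring
        _ ≤ 5 / 6 := by
          rw [div_le_div_iff₀ (by linarith) (by norm_num)]
          linarith
    refine (sq_le_sq₀ (norm_nonneg _) (by positivity)).1 ?_
    rw [mul_pow, Real.sq_sqrt (by norm_num)]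
    exact h1.trans (mul_le_mul_of_nonneg_right h2 (sq_nonneg _))
  apply isUnit_one_sub_of_norm_lt_one
  have h1 : ‖perturbOp κ z ω‖ ≤ Real.sqrt (5 / 6) :=
    ContinuousLinearMap.opNorm_le_bound _ (Real.sqrt_nonneg _) hb
  have h2 : Real.sqrt (5 / 6) < 1 := by
    rw [Real.sqrt_lt' one_pos]
    norm_num
  rw [norm_smul]
  calc ‖ζ‖ * ‖perturbOp κ z ω‖ ≤ 1 * Real.sqrt (5 / 6) := by gcongr
    _ < 1 := by rwa [one_mul]

/-! ### Large real parts -/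

/-- The operator `S f R S`, where `S` is the multiplier `1 / (z - 2n)`, `f` the multiplication by
`f ∈ L²` and `R` the reflection. -/
def sandwich (z : ℂ) (f : L2) : L2 →L[ℂ] Cb := multB z ∘L mulB.flip f ∘L reflB ∘L multB z

lemma sandwich_apply (z : ℂ) (f g : L2) :
    sandwich z f g = multB z (mulB (reflB (multB z g)) f) := rfl

lemma norm_sandwich_le (z : ℂ) (f g : L2) : ‖sandwich z f g‖ ≤ sig z ^ 2 * ‖f‖ * ‖g‖ := by
  rw [sandwich_apply]
  have h1 := norm_multB_le z (mulB (reflB (multB z g)) f)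
  have h2 := norm_mulB_le (reflB (multB z g)) f
  have h3 := (norm_reflB_le (multB z g)).trans (norm_multB_le z g)
  calc _ ≤ sig z * ‖mulB (reflB (multB z g)) f‖ := h1
    _ ≤ sig z * ((sig z * ‖g‖) * ‖f‖) :=
      mul_le_mul_of_nonneg_left (h2.trans (mul_le_mul_of_nonneg_right h3 (norm_nonneg _)))
        (sig_nonneg z)
    _ = _ := by ring

/-- The partial fraction identity `1/(ab) = (1/a + 1/b)/(a + b)`, where `a = z - 2k` and
`b = z - 2(m - k)` have a sum independent of `k`. -/
lemma sandwich_expFun {z : ℂ} (hz : ∀ n : ℤ, z - 2 * n ≠ 0) (m : ℤ) (g : L2) :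
    (2 * z - 2 * m) • sandwich z (expFun (2 * m)) g =
      expB m * reflB (multB z g) + multB z (mulB (expB m) (reflect g)) := by
  have hrefl : ∀ k : ℤ, reflect (expFun (2 * k)) = expFun (2 * -k) := by
    intro k
    apply Lp.ext
    filter_upwards [coeFn_reflect (expFun (2 * k)), ae_reflect (coeFn_toL2 (expB k)),
      coeFn_toL2 (reflB (expB k))] with x h1 h2 h3
    rw [h1, ← toL2_expB, ← toL2_expB, h2, ← reflB_expB, h3, reflB_apply]
  have hmul : ∀ k l : ℤ, mulB (expB k) (expFun (2 * l)) = expFun (2 * (k + l)) := by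
    intro k l
    rw [← toL2_expB, mulB_toL2, ← toL2_expB]
    congr 1
    ext x
    exact expB_mul k l x
  have key : (2 * z - 2 * (m : ℂ)) • sandwich z (expFun (2 * m)) =
      ContinuousLinearMap.mul ℂ Cb (expB m) ∘L reflB ∘L multB z +
        multB z ∘L mulB (expB m) ∘L reflect := by
    apply clm_ext_expFun
    intro k
    have ha := hz k
    have hb := hz (m - k)
    simp only [smul_apply, add_apply, ContinuousLinearMap.comp_apply, sandwich_apply,
      multB_expFun, map_smul, reflB_expB, hrefl, hmul, ContinuousLinearMap.mul_apply']
    have e1 : expB m * expB (-k) = expB (m + -k) := by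
      ext x
      exact expB_mul m (-k) x
    have e2 : -k + m = m + -k := by ring
    have e3 : ((m + -k : ℤ) : ℂ) = ((m - k : ℤ) : ℂ) := by
      push_cast
      ring
    rw [e1, e2, e3, smul_smul, smul_smul, ← add_smul]
    congr 1
    field_simp
    push_cast
    ring
  exact congrArg (fun L : L2 →L[ℂ] Cb => L g) key

lemma norm_reflect (g : L2) : ‖reflect g‖ = ‖g‖ :=
  (Lp.compMeasurePreservingₗᵢ ℂ (fun x : ℝ => Real.pi - x) measurePreserving_reflect).norm_map g

lemma norm_sandwich_expFun_le {z : ℂ} (hz : ∀ n : ℤ, z - 2 * n ≠ 0) (m : ℤ) (g : L2) :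
    ‖z - m‖ * ‖sandwich z (expFun (2 * m)) g‖ ≤ sig z * ‖g‖ := by
  have h := congrArg norm (sandwich_expFun hz m g)
  have h1 : ‖expB m * reflB (multB z g)‖ ≤ sig z * ‖g‖ := by
    refine (norm_mul_le _ _).trans ?_
    refine (mul_le_of_le_one_left (norm_nonneg _) (norm_expB_le m)).trans ?_
    exact (norm_reflB_le _).trans (norm_multB_le z g)
  have h2 : ‖multB z (mulB (expB m) (reflect g))‖ ≤ sig z * ‖g‖ := by
    refine (norm_multB_le _ _).trans (mul_le_mul_of_nonneg_left ?_ (sig_nonneg z))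
    refine (norm_mulB_le _ _).trans ?_
    rw [norm_reflect]
    exact mul_le_of_le_one_left (norm_nonneg _) (norm_expB_le m)
  have h3 := norm_add_le (expB m * reflB (multB z g)) (multB z (mulB (expB m) (reflect g)))
  rw [← h, norm_smul, show 2 * z - 2 * (m : ℂ) = 2 * (z - m) by ring, norm_mul,
    Complex.norm_ofNat] at h3
  linarith

/-- The operators `S f R S` tend to zero in norm as `z` goes to infinity at a distance at least
`1/4` from the even integers. -/
def Decays (f : L2) : Prop :=
  ∀ ε > 0, ∃ N : ℝ, ∀ z : ℂ, (∀ n : ℤ, 1 / 4 ≤ ‖z - 2 * n‖) → N ≤ ‖z‖ →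
    ∀ g : L2, ‖sandwich z f g‖ ≤ ε * ‖g‖

/-- A common bound for `sig z` off the discs of radius `1/4`. -/
lemma exists_sig_bound : ∃ C : ℝ, 0 < C ∧
    ∀ z : ℂ, (∀ n : ℤ, 1 / 4 ≤ ‖z - 2 * n‖) → sig z ≤ C := by
  have hs : 0 ≤ ∑' n : ℤ, 1 / (n : ℝ) ^ 2 := tsum_nonneg fun _ => by positivity
  refine ⟨Real.sqrt (16 + ∑' n : ℤ, 1 / (n : ℝ) ^ 2), Real.sqrt_pos.2 (by linarith),
    fun z hz => Real.sqrt_le_sqrt (tsum_inv_sq_le_of_dist hz)⟩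

lemma ne_zero_of_dist {z : ℂ} (hz : ∀ n : ℤ, 1 / 4 ≤ ‖z - 2 * n‖) (n : ℤ) : z - 2 * n ≠ 0 := by
  intro h
  have := hz n
  rw [h, norm_zero] at this
  norm_num at this

lemma decays_expFun (m : ℤ) : Decays (expFun (2 * m)) := by
  obtain ⟨C, hC, hσ⟩ := exists_sig_bound
  intro ε hε
  refine ⟨C / ε + ‖(m : ℂ)‖, fun z hz hN g => ?_⟩
  have h1 := norm_sandwich_expFun_le (ne_zero_of_dist hz) m g
  have h2 : C / ε ≤ ‖z - m‖ := by
    have := norm_sub_norm_le z (m : ℂ)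
    linarith
  have h3 : C / ε * ‖sandwich z (expFun (2 * m)) g‖ ≤ C * ‖g‖ :=
    (mul_le_mul_of_nonneg_right h2 (norm_nonneg _)).trans
      (h1.trans (mul_le_mul_of_nonneg_right (hσ z hz) (norm_nonneg _)))
  rw [div_mul_eq_mul_div, div_le_iff₀ hε, mul_assoc] at h3
  have := le_of_mul_le_mul_left h3 hC
  linarith

lemma sandwich_add (z : ℂ) (f f' g : L2) :
    sandwich z (f + f') g = sandwich z f g + sandwich z f' g := by
  simp only [sandwich_apply, map_add]

lemma sandwich_smul (z c : ℂ) (f g : L2) : sandwich z (c • f) g = c • sandwich z f g := by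
  simp only [sandwich_apply, map_smul]

lemma Decays.add {f f' : L2} (h : Decays f) (h' : Decays f') : Decays (f + f') := by
  intro ε hε
  obtain ⟨N, hN⟩ := h (ε / 2) (half_pos hε)
  obtain ⟨N', hN'⟩ := h' (ε / 2) (half_pos hε)
  refine ⟨max N N', fun z hz hzN g => ?_⟩
  rw [sandwich_add]
  refine (norm_add_le _ _).trans ?_
  have h1 := hN z hz ((le_max_left _ _).trans hzN) g
  have h2 := hN' z hz ((le_max_right _ _).trans hzN) g
  linarith

lemma Decays.smul {f : L2} (h : Decays f) (c : ℂ) : Decays (c • f) := by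
  intro ε hε
  obtain ⟨N, hN⟩ := h (ε / (‖c‖ + 1)) (by positivity)
  refine ⟨N, fun z hz hzN g => ?_⟩
  rw [sandwich_smul, norm_smul]
  have h1 := hN z hz hzN g
  calc ‖c‖ * ‖sandwich z f g‖ ≤ (‖c‖ + 1) * (ε / (‖c‖ + 1) * ‖g‖) := by gcongr; linarith
    _ = ε * ‖g‖ := by field_simp

/-- The approximation of `f` by trigonometric polynomials reduces this to exponentials. -/
lemma decays (f : L2) : Decays f := by
  have hspan : ∀ f ∈ Submodule.span ℂ (Set.range expBasis), Decays f := by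
    intro f hf
    induction hf using Submodule.span_induction with
    | mem x hx =>
      obtain ⟨m, rfl⟩ := hx
      rw [coe_expBasis]
      exact decays_expFun m
    | zero =>
      have := (decays_expFun 0).smul 0
      rwa [zero_smul] at this
    | add x y _ _ hx hy => exact hx.add hy
    | smul c x _ hx => exact hx.smul c
  obtain ⟨C, hC, hσ⟩ := exists_sig_bound
  intro ε hε
  have hcl : f ∈ closure (Submodule.span ℂ (Set.range expBasis) : Set L2) :=
    (Submodule.dense_iff_topologicalClosure_eq_top.2 expBasis.dense_span) f
  obtain ⟨f₀, hf₀, hdist⟩ := Metric.mem_closure_iff.1 hcl (ε / (2 * C ^ 2)) (by positivity)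
  obtain ⟨N, hN⟩ := hspan f₀ hf₀ (ε / 2) (half_pos hε)
  refine ⟨N, fun z hz hzN g => ?_⟩
  have e : sandwich z f g = sandwich z f₀ g + sandwich z (f - f₀) g := by
    rw [← sandwich_add, add_sub_cancel]
  rw [dist_eq_norm] at hdist
  have h1 := hN z hz hzN g
  have h2 : ‖sandwich z (f - f₀) g‖ ≤ ε / 2 * ‖g‖ := by
    refine (norm_sandwich_le z _ g).trans (mul_le_mul_of_nonneg_right ?_ (norm_nonneg _))
    calc sig z ^ 2 * ‖f - f₀‖ ≤ C ^ 2 * (ε / (2 * C ^ 2)) :=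
          mul_le_mul (pow_le_pow_left₀ (sig_nonneg z) (hσ z hz) 2) hdist.le (norm_nonneg _)
            (sq_nonneg _)
      _ = ε / 2 := by field_simp
  rw [e]
  refine (norm_add_le _ _).trans ?_
  linarith

/-- Every term of `(A⁻¹ v A D)²` contains one of the operators `sandwich z f`, where `f` is an entry of
`A⁻¹ v A`. -/
lemma norm_perturbOp_perturbOp_le {κ z : ℂ} (hκ : ‖κ‖ ≤ 1) {ω : Fin 2 → H} {ρ C ε : ℝ}
    (hε : 0 ≤ ε) (hρ : 0 ≤ ρ) (hω : ∀ ν, ‖(ω ν).fst‖ ≤ ρ ∧ ‖(ω ν).snd‖ ≤ ρ)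
    (hz : ∀ n : ℤ, 1 / 4 ≤ ‖z - 2 * n‖) (hσ : sig z ≤ C)
    (hs : ∀ ν (q : L2), ‖sandwich z (ω ν).fst q‖ ≤ ε * ‖q‖ ∧ ‖sandwich z (ω ν).snd q‖ ≤ ε * ‖q‖)
    (g : H) :
    ‖perturbOp κ z ω (perturbOp κ z ω g)‖ ≤ 2 * ρ * ((20 + 10 * C) * ε) * ‖g‖ := by
  set q₀ : L2 := g.fst - (Complex.I * κ) • mult z g.snd with hq₀
  have hC : 0 ≤ C := (sig_nonneg z).trans hσ
  have n0 : ‖q₀‖ ≤ 5 * ‖g‖ := by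
    have h1 := norm_sub_smul_mult_le hκ (by norm_num : (0 : ℝ) < 1 / 4) hz g.fst g.snd
    norm_num at h1
    have h2 := norm_fst_le g
    have h3 := norm_snd_le g
    linarith
  have n1 : ‖g.snd‖ ≤ 5 * ‖g‖ := (norm_snd_le g).trans (by linarith [norm_nonneg g])
  have b1 : ‖multB z (perturbOp κ z ω g).fst‖ ≤ 10 * ε * ‖g‖ := by
    have e : multB z (perturbOp κ z ω g).fst =
        sandwich z (ω 0).fst q₀ + sandwich z (ω 1).fst g.snd := by
      rw [perturbOp_fst, map_add]
      rfl
    rw [e]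
    refine (norm_add_le _ _).trans ?_
    have h1 := ((hs 0 q₀).1).trans (mul_le_mul_of_nonneg_left n0 hε)
    have h2 := ((hs 1 g.snd).1).trans (mul_le_mul_of_nonneg_left n1 hε)
    linarith
  have b2 : ‖multB z (perturbOp κ z ω g).snd‖ ≤ 10 * ε * ‖g‖ := by
    have e : multB z (perturbOp κ z ω g).snd =
        sandwich z (ω 0).snd q₀ + sandwich z (ω 1).snd g.snd := by
      rw [perturbOp_snd, map_add]
      rfl
    rw [e]
    refine (norm_add_le _ _).trans ?_
    have h1 := ((hs 0 q₀).2).trans (mul_le_mul_of_nonneg_left n0 hε)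
    have h2 := ((hs 1 g.snd).2).trans (mul_le_mul_of_nonneg_left n1 hε)
    linarith
  have c1 : ‖solB₁ z (perturbOp κ z ω g)‖ ≤ 10 * ε * ‖g‖ := b2
  have c0 : ‖solB₀ κ z (perturbOp κ z ω g)‖ ≤ 10 * ε * ‖g‖ + C * (10 * ε * ‖g‖) := by
    rw [solB₀_eq, map_sub, map_smul]
    refine (norm_sub_le _ _).trans (add_le_add b1 ?_)
    rw [norm_smul, norm_mul, Complex.norm_I, one_mul]
    refine (mul_le_of_le_one_left (norm_nonneg _) hκ).trans ((norm_multB_le z _).trans ?_)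
    exact mul_le_mul hσ ((norm_toL2_le _).trans b2) (norm_nonneg _) hC
  have hsum : ‖solB₀ κ z (perturbOp κ z ω g)‖ + ‖solB₁ z (perturbOp κ z ω g)‖ ≤
      (20 + 10 * C) * ε * ‖g‖ := by linarith
  have h1 := norm_perturbOp_sq_le hω (z := z) (κ := κ) (perturbOp κ z ω g)
  refine (sq_le_sq₀ (norm_nonneg _) (by positivity)).1 (h1.trans ?_)
  calc _ ≤ 2 * ρ ^ 2 * ((20 + 10 * C) * ε * ‖g‖) ^ 2 := by gcongr
    _ ≤ 4 * ρ ^ 2 * ((20 + 10 * C) * ε * ‖g‖) ^ 2 := by gcongr; norm_num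
    _ = _ := by ring

lemma isUnit_one_sub_of_mul_self {R : Type*} [Ring R] {B : R} (h : IsUnit (1 - B * B)) :
    IsUnit (1 - B) := by
  have hfac : (1 - B) * (1 + B) = 1 - B * B := by noncomm_ring
  have hcomm : Commute (1 - B) (1 + B) := by
    change (1 - B) * (1 + B) = (1 + B) * (1 - B)
    noncomm_ring
  rw [← hfac] at h
  exact (hcomm.isUnit_mul_iff.1 h).1

/-- The square of `A⁻¹ v A D` tends to zero in norm. Hence `1 - ζ A⁻¹ v A D` is invertible, as a
factor of `1 - (ζ A⁻¹ v A D)²`. -/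
lemma exists_isUnit_of_norm {κ : ℂ} (hκ : ‖κ‖ ≤ 1) (ω : Fin 2 → H) :
    ∃ N : ℝ, ∀ z : ℂ, (∀ n : ℤ, 1 / 4 ≤ ‖z - 2 * n‖) → N ≤ ‖z‖ →
      ∀ ζ : ℂ, ‖ζ‖ ≤ 1 → IsUnit (1 - ζ • perturbOp κ z ω) := by
  obtain ⟨C, hC, hσ⟩ := exists_sig_bound
  set ρ := ‖ω 0‖ + ‖ω 1‖ with hρ
  have hρ0 : 0 ≤ ρ := by positivity
  have hle : ∀ ν, ‖ω ν‖ ≤ ρ := by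
    intro ν
    fin_cases ν
    · exact le_add_of_nonneg_right (norm_nonneg _)
    · exact le_add_of_nonneg_left (norm_nonneg _)
  have hω : ∀ ν, ‖(ω ν).fst‖ ≤ ρ ∧ ‖(ω ν).snd‖ ≤ ρ := fun ν =>
    ⟨(norm_fst_le _).trans (hle ν), (norm_snd_le _).trans (hle ν)⟩
  set ε : ℝ := 1 / (4 * (ρ + 1) * (20 + 10 * C)) with hε
  have hεpos : 0 < ε := by positivity
  have h1 : ∀ ν, ∃ N : ℝ, ∀ z : ℂ, (∀ n : ℤ, 1 / 4 ≤ ‖z - 2 * n‖) → N ≤ ‖z‖ →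
      ∀ q : L2, ‖sandwich z (ω ν).fst q‖ ≤ ε * ‖q‖ := fun ν => decays (ω ν).fst ε hεpos
  have h2 : ∀ ν, ∃ N : ℝ, ∀ z : ℂ, (∀ n : ℤ, 1 / 4 ≤ ‖z - 2 * n‖) → N ≤ ‖z‖ →
      ∀ q : L2, ‖sandwich z (ω ν).snd q‖ ≤ ε * ‖q‖ := fun ν => decays (ω ν).snd ε hεpos
  choose N₁ hN₁ using h1
  choose N₂ hN₂ using h2
  refine ⟨max (max (N₁ 0) (N₁ 1)) (max (N₂ 0) (N₂ 1)), fun z hz hzN ζ hζ => ?_⟩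
  obtain ⟨⟨l1, l2⟩, l3, l4⟩ : (N₁ 0 ≤ ‖z‖ ∧ N₁ 1 ≤ ‖z‖) ∧ N₂ 0 ≤ ‖z‖ ∧ N₂ 1 ≤ ‖z‖ := by
    simpa only [max_le_iff] using hzN
  have hs : ∀ ν (q : L2),
      ‖sandwich z (ω ν).fst q‖ ≤ ε * ‖q‖ ∧ ‖sandwich z (ω ν).snd q‖ ≤ ε * ‖q‖ := by
    intro ν q
    fin_cases ν
    · exact ⟨hN₁ 0 z hz l1 q, hN₂ 0 z hz l3 q⟩
    · exact ⟨hN₁ 1 z hz l2 q, hN₂ 1 z hz l4 q⟩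
  have hsq : ‖perturbOp κ z ω * perturbOp κ z ω‖ ≤ 1 / 2 := by
    refine ContinuousLinearMap.opNorm_le_bound _ (by norm_num) fun g => ?_
    refine (norm_perturbOp_perturbOp_le hκ hεpos.le hρ0 hω hz (hσ z hz) hs g).trans
      (mul_le_mul_of_nonneg_right ?_ (norm_nonneg _))
    calc 2 * ρ * ((20 + 10 * C) * ε) ≤ 2 * (ρ + 1) * ((20 + 10 * C) * ε) := by gcongr; linarith
      _ = 1 / 2 := by
        rw [hε]
        field_simp
        norm_num
  set B := ζ • perturbOp κ z ω with hB
  have hBB : ‖B * B‖ < 1 := by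
    have e : B * B = (ζ * ζ) • (perturbOp κ z ω * perturbOp κ z ω) := by
      rw [hB, smul_mul_smul_comm]
    rw [e, norm_smul, norm_mul]
    nlinarith [norm_nonneg ζ, norm_nonneg (perturbOp κ z ω * perturbOp κ z ω),
      mul_le_one₀ hζ (norm_nonneg ζ) hζ]
  exact isUnit_one_sub_of_mul_self (isUnit_one_sub_of_norm_lt_one hBB)

/-! ### Localization of the spectrum -/

lemma one_le_norm_mul_norm_inverse {A : H →L[ℂ] H} (hA : A.IsInvertible) :
    1 ≤ ‖A‖ * ‖A.inverse‖ := by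
  have hpos : 0 < ‖stdBasis 0 0‖ := by
    have h1 : ‖expFun 0‖ = 1 := by simpa using orthonormal_expFun.1 0
    have h2 : ‖expFun 0‖ ≤ ‖stdBasis 0 0‖ := norm_fst_le (stdBasis 0 0)
    linarith
  have h1 : ‖stdBasis 0 0‖ ≤ ‖A‖ * ‖A.inverse‖ * ‖stdBasis 0 0‖ := by
    calc ‖stdBasis 0 0‖ = ‖A (A.inverse (stdBasis 0 0))‖ := by rw [hA.self_apply_inverse]
      _ ≤ ‖A‖ * (‖A.inverse‖ * ‖stdBasis 0 0‖) :=
        A.le_opNorm_of_le (A.inverse.le_opNorm _)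
      _ = _ := by ring
  exact le_of_mul_le_mul_right (by rwa [one_mul]) hpos

open Classical in
lemma norm_ite_le (p : Prop) : ‖(if p then 0 else 1 : ℂ)‖ ≤ 1 := by
  split_ifs <;> simp

/-- There is no spectrum at distance at least `height` from the real axis. -/
lemma mem_resolventSet_of_im {M : Matrix (Fin 2) (Fin 4) ℂ} (hreg : IsRegular M)
    (hns : ¬ IsStrictlyRegular M) {P Q : ℝ → ℂ} (hP : MemLp P 2 muI) (hQ : MemLp Q 2 muI)
    {τ : ℂ} {α β : Fin 2 → ℂ} (hτ : IsExponent M τ) (hαβ : IsRootPair M α β) {ζ : ℂ}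
    (hζ : ‖ζ‖ ≤ 1) {w : ℂ} (hw : height M P Q τ α β ≤ |w.im|) :
    w ∈ resolventSet (op M (fun x => ζ * P x) (fun x => ζ * Q x)) := by
  classical
  have hd := rootData hreg hns hτ hαβ
  have hA := isInvertible_basisOpAux hd.indep (τ := τ)
  obtain ⟨ω, hω⟩ := exists_columns hA hP hQ
  set T := height M P Q τ α β with hT
  have hT1 : 1 ≤ T := le_max_left _ _
  have hT2 : 2 * |τ.im| ≤ T :=
    (mul_le_mul_of_nonneg_left (le_max_left _ _) zero_le_two).trans (le_max_right _ _)
  have hT3 : 192 * rNormSq (basisOp M τ α β) P Q ≤ T := by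
    have h1 : 2 * (96 * ‖basisOp M τ α β‖ * ‖(basisOp M τ α β).inverse‖ *
        rNormSq (basisOp M τ α β) P Q) ≤ T :=
      (mul_le_mul_of_nonneg_left (le_max_right _ _) zero_le_two).trans (le_max_right _ _)
    have h2 : 1 ≤ ‖basisOp M τ α β‖ * ‖(basisOp M τ α β).inverse‖ :=
      one_le_norm_mul_norm_inverse hA
    have h3 := mul_le_mul_of_nonneg_right h2 (rNormSq_nonneg (basisOp M τ α β) P Q)
    linarith
  have hz : T / 2 ≤ |(w - τ).im| := by
    rw [Complex.sub_im]
    have := abs_sub_abs_le_abs_sub w.im τ.im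
    linarith
  have hu := isUnit_of_im (norm_ite_le (IsPeriodicType M)) hζ (norm_columns_sq_le hA hω) hT1 hT3 hz
  have hne : ∀ n : ℤ, w - τ - 2 * n ≠ 0 := by
    intro n h
    have h1 := congrArg Complex.im h
    have h2 : (w - τ - 2 * (n : ℂ)).im = (w - τ).im := by simp
    rw [h2, Complex.zero_im] at h1
    rw [h1, abs_zero] at hz
    linarith
  have := mem_resolventSet_of_isUnit hreg hd hP hQ hω hne hu
  rwa [sub_add_cancel] at this

/-- There is no spectrum far away from the origin outside the discs of radius `1/4` around the
eigenvalues of the free operator. -/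
lemma exists_mem_resolventSet_of_norm {M : Matrix (Fin 2) (Fin 4) ℂ} (hreg : IsRegular M)
    (hns : ¬ IsStrictlyRegular M) {P Q : ℝ → ℂ} (hP : MemLp P 2 muI) (hQ : MemLp Q 2 muI)
    {τ : ℂ} {α β : Fin 2 → ℂ} (hτ : IsExponent M τ) (hαβ : IsRootPair M α β) :
    ∃ N : ℝ, ∀ w : ℂ, (∀ n : ℤ, 1 / 4 ≤ ‖w - τ - 2 * n‖) → N ≤ ‖w - τ‖ → ∀ ζ : ℂ, ‖ζ‖ ≤ 1 →
      w ∈ resolventSet (op M (fun x => ζ * P x) (fun x => ζ * Q x)) := by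
  classical
  have hd := rootData hreg hns hτ hαβ
  obtain ⟨ω, hω⟩ := exists_columns (isInvertible_basisOpAux hd.indep (τ := τ)) hP hQ
  obtain ⟨N, hN⟩ := exists_isUnit_of_norm (norm_ite_le (IsPeriodicType M)) ω
  refine ⟨N, fun w hw hwN ζ hζ => ?_⟩
  have := mem_resolventSet_of_isUnit hreg hd hP hQ hω (ne_zero_of_dist hw) (hN _ hw hwN ζ hζ)
  rwa [sub_add_cancel] at this

/-- Two admissible exponents differ by an even integer. -/
lemma IsExponent.exists_sub_eq {M : Matrix (Fin 2) (Fin 4) ℂ} {τ τ' : ℂ} (h : IsExponent M τ)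
    (h' : IsExponent M τ') : ∃ n : ℤ, τ - τ' = 2 * n := by
  have e := h.1.symm.trans h'.1
  rw [Complex.exp_eq_exp_iff_exists_int] at e
  obtain ⟨n, hn⟩ := e
  refine ⟨n, ?_⟩
  have hI : Complex.I * Real.pi ≠ 0 :=
    mul_ne_zero Complex.I_ne_zero (Complex.ofReal_ne_zero.2 Real.pi_ne_zero)
  apply mul_left_cancel₀ hI
  linear_combination hn

/-- Outside the discs `D_m`, `|m| > N`, and outside the strip `|Re (w - τ)| < N + 1`, the distance
to the points `τ + 2n` is at least `1/4`. -/
lemma dist_of_notMem_disc {τ w : ℂ} {N : ℕ} (hre : (N : ℝ) + 1 ≤ |w.re - τ.re|)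
    (hw : w ∉ ⋃ m ∈ {m : ℤ | Even m ∧ (N : ℤ) < |m|}, disc τ m) (n : ℤ) :
    1 / 4 ≤ ‖w - τ - 2 * n‖ := by
  by_cases hn : (N : ℤ) < |2 * n|
  · by_contra hlt
    apply hw
    simp only [mem_iUnion]
    refine ⟨2 * n, ⟨even_two_mul n, hn⟩, ?_⟩
    have : ‖w - τ - ((2 * n : ℤ) : ℂ)‖ < 1 / 4 := by
      push_cast
      exact not_le.1 hlt
    exact this
  · have h1 : |(2 * n : ℝ)| ≤ N := by exact_mod_cast not_lt.1 hn
    have h2 : (w - τ - 2 * (n : ℂ)).re = (w.re - τ.re) - 2 * n := by simp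
    have h3 := Complex.abs_re_le_norm (w - τ - 2 * (n : ℂ))
    rw [h2] at h3
    have h4 := abs_sub_abs_le_abs_sub (w.re - τ.re) (2 * (n : ℝ))
    linarith

end Dirac

end

theorem theorem14 (M : Matrix (Fin 2) (Fin 4) ℂ)
    (hreg : Dirac.IsRegular M) (hns : ¬ Dirac.IsStrictlyRegular M)
    (P Q : ℝ → ℂ) (hP : MeasureTheory.MemLp P 2 Dirac.muI)
    (hQ : MeasureTheory.MemLp Q 2 Dirac.muI) :
    ∃ N : ℕ, 0 < N ∧ Even N ∧
      ∀ (τ : ℂ) (α β : Fin 2 → ℂ), Dirac.IsExponent M τ → Dirac.IsRootPair M α β →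
        ∀ ζ : ℂ, ‖ζ‖ ≤ 1 →
          Dirac.Sp (Dirac.op M (fun x => ζ * P x) (fun x => ζ * Q x)) ⊆
            Dirac.rect τ N (Dirac.height M P Q τ α β) ∪
              ⋃ m ∈ {m : ℤ | Even m ∧ (N : ℤ) < |m|}, Dirac.disc τ m := by
  by_cases hex : ∃ (τ₀ : ℂ) (α₀ β₀ : Fin 2 → ℂ), Dirac.IsExponent M τ₀ ∧ Dirac.IsRootPair M α₀ β₀
  swap
  · exact ⟨2, two_pos, even_two, fun τ α β h1 h2 => absurd ⟨τ, α, β, h1, h2⟩ hex⟩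
  -- the bound for large real parts is taken from one choice of `τ`, `α`, `β`
  obtain ⟨τ₀, α₀, β₀, hτ₀, hαβ₀⟩ := hex
  obtain ⟨N₀, hN₀⟩ := Dirac.exists_mem_resolventSet_of_norm hreg hns hP hQ hτ₀ hαβ₀
  -- two admissible exponents have real parts at distance at most `2`, so `N + 1 ≥ N₀ + 2` is enough
  refine ⟨2 * (⌈N₀⌉₊ + 1), by positivity, even_two_mul _, fun τ α β hτ hαβ ζ hζ w hw => ?_⟩
  by_contra hout
  rw [Set.mem_union, not_or] at hout
  obtain ⟨hrect, hdisc⟩ := hout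
  apply hw
  by_cases him : |w.im| < Dirac.height M P Q τ α β
  swap
  · exact Dirac.mem_resolventSet_of_im hreg hns hP hQ hτ hαβ hζ (not_lt.1 him)
  have hre := not_lt.1 fun h => hrect ⟨h, him⟩
  have hdist := Dirac.dist_of_notMem_disc hre hdisc
  obtain ⟨k, hk⟩ := hτ.exists_sub_eq hτ₀
  refine hN₀ w (fun n => ?_) ?_ ζ hζ
  · have h1 := hdist (n - k)
    rwa [show w - τ - 2 * ((n - k : ℤ) : ℂ) = w - τ₀ - 2 * n by
      push_cast
      linear_combination -hk] at h1
  · have h1 := Complex.abs_re_le_norm (w - τ₀)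
    have h2 := abs_sub_abs_le_abs_sub (w.re - τ.re) (τ₀.re - τ.re)
    have h3 := abs_sub τ₀.re τ.re
    have h4 := hτ.2
    have h5 := hτ₀.2
    have h6 := Nat.le_ceil N₀
    have h7 : (w - τ₀).re = w.re - τ.re - (τ₀.re - τ.re) := by
      rw [Complex.sub_re]
      ring
    rw [← h7] at h2
    push_cast at hre
    have h8 : (0 : ℝ) ≤ (⌈N₀⌉₊ : ℝ) := Nat.cast_nonneg _
    linarith
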